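/- **Setting.** An *extended Coxeter group* is a semidirect product $W=W_{\mathrm{aff}}\rtimes\Omega$ of a Coxeter group $(W_{\mathrm{aff}},S)$ and a subgroup $\Omega\le W$ whose conjugation action preserves $S$; put $\ell(w'u)=\ell(w')$ for $w'\in W_{\mathrm{aff}}$, $u\in\Omega$. Its *hyperplanes* are the reflections, i.e. the elements of $\mathfrak H=\{wsw^{-1}:w\in W_{\mathrm{aff}},\,s\in S\}$. A hyperplane $H$ *separates* $w_1,w_2\in W_{\mathrm{aff}}$ if $\rho(w_2^{-1}w_1)(w_1^{-1}Hw_1,1)=(w_2^{-1}Hw_2,-1)$, where $\rho$ is the action of $W_{\mathrm{aff}}$ on $\mathfrak H\times\{\pm1\}$ in which $s\in S$ sends $(s,\varepsilon)$ to $(s,-\varepsilon)$ and $(H,\varepsilon)$ to $(sHs^{-1},\varepsilon)$ for $H\ne s$; elements $w'u\in W$ are treated here as $w'$. A *pro-$p$ Coxeter group* $W^{(1)}$ is an extension $1\to T\to W^{(1)}\xrightarrow{\ \pi\ }W\to1$ of an extended Coxeter group by an abelian group $T$, with lifts $n_s\in\pi^{-1}(s)$ $(s\in S)$ satisfying the braid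 relations $n_sn_tn_s\cdots=n_tn_sn_t\cdots$ ($m(s,t)$ factors) whenever $m(s,t)=\mathrm{ord}(st)<\infty$. Put $\ell=\ell\circ\pi$ and $\Omega^{(1)}=\pi^{-1}(\Omega)$. Elements of $W^{(1)}$ are viewed in $W$ via $\pi$ when one speaks of hyperplanes separating them. An *orientation* of $(W_{\mathrm{aff}},S)$ is a map $\mathfrak o:W_{\mathrm{aff}}\times S\to\{\pm1\}$ such that $\mathfrak o(ws,s)=-\mathfrak o(w,s)$ and such that, for all $s,t\in S$ with $m=m(s,t)<\infty$ and all $w$, there are $0\le k\le m$ and a sign $\varepsilon$ for which the sequences $(\mathfrak o(w,s),\mathfrak o(ws,t),\mathfrak o(wst,s),\dots)$ and $(\mathfrak o(w,t),\mathfrak o(wt,s),\mathfrak o(wts,t),\dots)$ of length $m$ are $(\varepsilon,\dots,\varepsilon,-\varepsilon,\dots,-\varepsilon)$ with $k$ leading entries $\varepsilon$ and $(-\varepsilon,\dots,-\varepsilon,\varepsilon,\dots,\varepsilon)$ with $k$ final entries $\varepsilon$. An *orientation* of $W^{(1)}$ is a map $W^{(1)}\times S\to\{\pm1\}$ of the form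 $(g,s)\mapsto\mathfrak o(w,\,usu^{-1})$ where $\pi(g)=wu$, $w\in W_{\mathrm{aff}}$, $u\in\Omega$, for an orientation $\mathfrak o$ of $(W_{\mathrm{aff}},S)$. Put $(\mathfrak o\bullet g)(g',s)=\mathfrak o(gg',s)$; this depends only on $\pi(g)$, so $W$ acts on orientations. For $H\in\mathfrak H$ put $\mathfrak o(1,H)=\mathfrak o(w_0,s)$, where $w_0\in W$ (lifted to $W^{(1)}$) and $s\in S$ are such that $w_0sw_0^{-1}=H$ and $H$ does not separate $1$ and $w_0$ (this is independent of the choice). Two orientations $\mathfrak o,\mathfrak o'$ *disagree* at $H$ if $\mathfrak o(1,H)\ne\mathfrak o'(1,H)$. They are *adjacent* if $\mathfrak o\bullet H=\mathfrak o'$ for every $H\in\mathfrak H$ at which they disagree, where $H$ is regarded as a reflection in $W$. Let $R$ be a commutative ring and let $a_s\in R$, $b_s\in R[T]$ $(s\in S)$ be such that, whenever $s\,\pi(w)=\pi(w)\,t$ with $s,t\in S$, $w\in W^{(1)}$, one has $a_s=a_t$ and $(n_swn_t^{-1}w^{-1})\,w(b_t)=b_s$, where $w(\cdot)$ is the action on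 $R[T]$ induced by conjugation on $T$. Let $\mathcal H^{(1)}$ be the generic pro-$p$ Hecke algebra, the $R$-algebra with $R$-basis $(T_w)_{w\in W^{(1)}}$, $T_{ww'}=T_wT_{w'}$ if $\ell(ww')=\ell(w)+\ell(w')$, and $T_{n_s}^2=a_sT_{n_s^2}+T_{n_s}b_s$, where $R[T]\subseteq\mathcal H^{(1)}$ via $t\mapsto T_t$. Assume that every $a_s$ is a unit and a square in $R$, and choose a square root $\sqrt{a_{[s]}}\in R^\times$ of $a_s$ for every $W$-conjugacy class $[s]$ in $\mathfrak H$. For an orientation $\mathfrak o$ of $W^{(1)}$ and $w=n_{s_1}\cdots n_{s_r}u$ with $u\in\Omega^{(1)}$, $r=\ell(w)$, put $$\widehat\theta_{\mathfrak o}(w)=T_1\cdots T_rT_u,\qquad T_i=\begin{cases}T_{n_{s_i}}&\text{if }\mathfrak o(n_{s_1}\cdots n_{s_{i-1}},s_i)=+1,\\T_{n_{s_i}}-b_{s_i}&\text{if }\mathfrak o(n_{s_1}\cdots n_{s_{i-1}},s_i)=-1,\end{cases}$$ $$\widetilde\theta_{\mathfrak o}(w)=\Big(\prod_{H\text{ separates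 }1,w}\sqrt{a_{[H]}}\Big)^{-1}\widehat\theta_{\mathfrak o}(w),\qquad \Xi_{\mathfrak o}(H)=\sqrt{a_{[s]}}^{\,-1}\,v(b_s)\,\widetilde\theta_{\mathfrak o}(v n_s^{-1}v^{-1}),$$ where $v\in W^{(1)}$, $s\in S$ are such that $\pi(vn_sv^{-1})=H$. These elements do not depend on the choices of the reduced expression and of $(v,s)$. **Theorem.** Let $\mathfrak o,\mathfrak o'$ be adjacent orientations of $W^{(1)}$. Then for all $w\in W^{(1)}$ $$\widetilde\theta_{\mathfrak o}(w)-\widetilde\theta_{\mathfrak o'}(w)=\Big(\sum_H\mathfrak o(1,H)\,\Xi_{\mathfrak o'}(H)\Big)\,\widetilde\theta_{\mathfrak o}(w),$$ where the sum runs over the hyperplanes $H\in\mathfrak H$ which separate $1$ and $w$ and at which $\mathfrak o$ and $\mathfrak o'$ disagree. -/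

import Mathlib

namespace ProP

section CoxeterSystem

variable {B A : Type*} {M : CoxeterMatrix B} [Group A] (cs : CoxeterSystem M A)

/-- The set of walls (reflections) `w s w⁻¹` of a Coxeter system. -/
abbrev Refl := {t : A // cs.IsReflection t}

/-- The conjugate `w t w⁻¹` of a wall. -/
def Refl.conj {cs : CoxeterSystem M A} (w : A) (t : Refl cs) : Refl cs :=
  ⟨w * t.1 * w⁻¹, t.2.conj w⟩

open Classical in
/-- The action of a simple reflection `s` on `walls × {±1}`:
`(H, ε) ↦ (s H s⁻¹, -ε)` if `H = s` and `(H, ε) ↦ (s H s⁻¹, ε)` otherwise. -/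
noncomputable def simpleStep (i : B) (p : Refl cs × ℤˣ) : Refl cs × ℤˣ :=
  (p.1.conj (cs.simple i), if p.1.1 = cs.simple i then -p.2 else p.2)

theorem simpleStep_involutive (i : B) : Function.Involutive (simpleStep cs i) := by
  rintro ⟨⟨t, ht⟩, e⟩
  have h1 : cs.simple i * t * cs.simple i = cs.simple i ↔ t = cs.simple i := by
    constructor
    · intro h
      have := congrArg (fun x => cs.simple i * x * cs.simple i) h
      simpa [mul_assoc] using this
    · rintro rfl; simp
  by_cases h : t = cs.simple i
  · subst h
    simp [simpleStep, Refl.conj]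
  · simp only [simpleStep, Refl.conj, h, cs.inv_simple, h1, if_false]
    simp [mul_assoc]

/-- `simpleStep` as a permutation. -/
noncomputable def simplePerm (i : B) : Equiv.Perm (Refl cs × ℤˣ) :=
  (simpleStep_involutive cs i).toPerm

open Classical in
theorem simplePerm_mul_pow (i j : B) (m : ℕ) (t : Refl cs) (e : ℤˣ) :
    ((simplePerm cs i * simplePerm cs j) ^ m) (t, e) =
      (t.conj ((cs.simple i * cs.simple j) ^ m),
        e * ∏ k ∈ Finset.range (2 * m),
          (if t.1 = cs.simple j * (cs.simple i * cs.simple j) ^ k then (-1 : ℤˣ) else 1)) := by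
  induction m with
  | zero => simp [Refl.conj]
  | succ m ih =>
    rw [pow_succ', Equiv.Perm.mul_apply, ih, show 2 * (m + 1) = 2 * m + 1 + 1 by ring,
      Finset.prod_range_succ, Finset.prod_range_succ]
    obtain ⟨t, ht⟩ := t
    set p := cs.simple i * cs.simple j with hp
    have hsj : cs.simple j * p ^ m = (p ^ m)⁻¹ * cs.simple j := by
      have h1 : cs.simple j * p * (cs.simple j)⁻¹ = p⁻¹ := by simp [hp, mul_assoc]
      have h2 : cs.simple j * p ^ m * (cs.simple j)⁻¹ = (p ^ m)⁻¹ := by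
        rw [← conj_pow, h1, inv_pow]
      rw [← h2]; simp [mul_assoc]
    have e1 : p ^ m * t * (p ^ m)⁻¹ = cs.simple j ↔ t = cs.simple j * p ^ (2 * m) := by
      rw [two_mul, pow_add, ← mul_assoc, hsj, mul_inv_eq_iff_eq_mul, mul_assoc, eq_inv_mul_iff_mul_eq]
    have e2 : cs.simple j * (p ^ m * t * (p ^ m)⁻¹) * cs.simple j = cs.simple i ↔
        t = cs.simple j * p ^ (2 * m + 1) := by
      have : cs.simple j * p ^ (2 * m + 1) = (p ^ m)⁻¹ * (cs.simple j * p) * p ^ m := by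
        rw [show 2 * m + 1 = m + 1 + m by ring, pow_add, pow_succ, ← mul_assoc, ← mul_assoc, hsj]
        simp [mul_assoc]
      rw [this]
      constructor
      · intro h
        have h2 := congrArg (fun x => (p ^ m)⁻¹ * (cs.simple j * x * cs.simple j) * p ^ m) h
        simpa [mul_assoc, hp] using h2
      · rintro rfl
        simp [mul_assoc, hp]
    refine Prod.ext (Subtype.ext ?_) ?_
    · simp [simplePerm, simpleStep, Refl.conj, mul_assoc, pow_succ', hp]
    · simp only [simplePerm, simpleStep, Refl.conj, Equiv.Perm.mul_apply,
        Function.Involutive.coe_toPerm, cs.inv_simple]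
      simp only [e1, e2]
      split_ifs <;> simp

theorem simplePerm_liftable : M.IsLiftable (simplePerm cs) := by
  classical
  intro i j
  refine Equiv.ext ?_
  rintro ⟨t, e⟩
  rw [simplePerm_mul_pow, cs.simple_mul_simple_pow, two_mul, Finset.prod_range_add]
  have : ∀ k, (cs.simple i * cs.simple j) ^ (M i j + k) = (cs.simple i * cs.simple j) ^ k := by
    intro k; rw [pow_add, cs.simple_mul_simple_pow, one_mul]
  simp only [this]
  simp [Refl.conj]

/-- The canonical action `ρ` of a Coxeter group on `walls × {±1}`. -/
noncomputable def canonicalAction : A →* Equiv.Perm (Refl cs × ℤˣ) :=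
  cs.lift ⟨simplePerm cs, simplePerm_liftable cs⟩

theorem canonicalAction_simple (i : B) (p : Refl cs × ℤˣ) :
    canonicalAction cs (cs.simple i) p = simpleStep cs i p := by
  rw [canonicalAction, cs.lift_apply_simple]; rfl

/-- The wall `t` separates the chambers `w₁` and `w₂`. -/
def Separates (t : Refl cs) (w₁ w₂ : A) : Prop :=
  canonicalAction cs (w₂⁻¹ * w₁) (t.conj w₁⁻¹, 1) = (t.conj w₂⁻¹, -1)

theorem canonicalAction_apply (w : A) (t : Refl cs) (e : ℤˣ) :
    canonicalAction cs w (t, e) = (t.conj w, e * (canonicalAction cs w (t, 1)).2) := by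
  induction w using cs.simple_induction_left generalizing t e with
  | one => simp [Refl.conj]
  | mul_simple_left w i ih =>
    rw [map_mul, Equiv.Perm.mul_apply, Equiv.Perm.mul_apply, ih t e, ih t 1,
      canonicalAction_simple, canonicalAction_simple]
    refine Prod.ext (Subtype.ext ?_) ?_
    · simp [simpleStep, Refl.conj, mul_assoc]
    · simp only [simpleStep]
      split_ifs <;> simp

theorem canonicalAction_self (t : Refl cs) (e : ℤˣ) :
    canonicalAction cs t.1 (t, e) = (t, -e) := by
  obtain ⟨t, w, i, rfl⟩ := t
  set s : Refl cs := ⟨cs.simple i, cs.isReflection_simple i⟩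
  have h1 := canonicalAction_apply cs w s
  have key : ∀ e, canonicalAction cs w (s, e) =
      (⟨w * cs.simple i * w⁻¹, w, i, rfl⟩, e * (canonicalAction cs w (s, 1)).2) := h1
  set c := (canonicalAction cs w (s, 1)).2
  have h2 : (⟨w * cs.simple i * w⁻¹, w, i, rfl⟩, e) = canonicalAction cs w (s, e * c) := by
    rw [key]; simp [mul_assoc]
  have h3 : canonicalAction cs (cs.simple i) (s, e * c) = (s, -(e * c)) := by
    rw [canonicalAction_simple]; simp [simpleStep, s, Refl.conj]
  rw [h2, map_mul, map_mul, Equiv.Perm.mul_apply, Equiv.Perm.mul_apply, ← Equiv.Perm.mul_apply _ _ (s, e * c),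
    ← map_mul, inv_mul_cancel, map_one, Equiv.Perm.one_apply, h3, key]
  simp [mul_assoc]

theorem canonicalAction_word (l : List B) (t : Refl cs)
    (h : (canonicalAction cs (cs.wordProd l) (t, 1)).2 = -1) : t.1 ∈ cs.rightInvSeq l := by
  induction l with
  | nil => simp at h
  | cons i l ih =>
    rw [cs.wordProd_cons, map_mul, Equiv.Perm.mul_apply, canonicalAction_apply cs (cs.wordProd l),
      canonicalAction_simple] at h
    simp only [simpleStep, one_mul] at h
    refine List.mem_cons.2 ?_
    split_ifs at h with h1
    · left
      rw [← h1]; simp [Refl.conj, mul_assoc]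
    · exact Or.inr (ih h)

theorem sign_eq_iff (w : A) (t : Refl cs) :
    (canonicalAction cs w⁻¹ (t, 1)).2 = -1 ↔ cs.length (t.1 * w) < cs.length w := by
  have key : ∀ v : A, (canonicalAction cs v⁻¹ (t, 1)).2 = -1 →
      cs.length (t.1 * v) < cs.length v := by
    intro v hv
    obtain ⟨l, hl, rfl⟩ := cs.exists_isReduced v
    rw [← cs.wordProd_reverse] at hv
    have := canonicalAction_word cs _ t hv
    rw [cs.rightInvSeq_reverse, List.mem_reverse] at this
    exact (cs.isLeftInversion_of_mem_leftInvSeq hl this).2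
  refine ⟨key w, fun h => ?_⟩
  by_contra hne
  have h1 : (canonicalAction cs w⁻¹ (t, 1)).2 = 1 := (Int.units_eq_one_or _).resolve_right hne
  have h2 := key (t.1 * w) (by
    rw [mul_inv_rev, t.2.inv, map_mul, Equiv.Perm.mul_apply, canonicalAction_self,
      canonicalAction_apply, h1]; simp)
  rw [← mul_assoc, t.2.mul_self, one_mul] at h2
  omega

theorem separates_one_iff (w : A) (t : Refl cs) :
    Separates cs t 1 w ↔ cs.length (t.1 * w) < cs.length w := by
  rw [← sign_eq_iff]
  have ht : t.conj (1 : A)⁻¹ = t := Subtype.ext (by simp [Refl.conj])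
  rw [Separates, mul_one, ht]
  constructor
  · intro h; rw [h]
  · intro h; rw [canonicalAction_apply, h]; simp

theorem separates_one_finite (w : A) : {t : Refl cs | Separates cs t 1 w}.Finite := by
  obtain ⟨l, hl, hw⟩ := cs.exists_isReduced w
  refine Set.Finite.subset
    (Set.Finite.preimage Subtype.val_injective.injOn (cs.leftInvSeq l).finite_toSet) ?_
  intro t ht
  have ht' := (sign_eq_iff cs w t).2 ((separates_one_iff cs w t).1 ht)
  rw [hw, ← cs.wordProd_reverse] at ht'
  have := canonicalAction_word cs _ t ht'
  rw [cs.rightInvSeq_reverse, List.mem_reverse] at this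
  exact this

theorem simple_mul_eq_mul_simple {w : A} {i j : B}
    (h : cs.length (cs.simple i * w * cs.simple j) = cs.length w)
    (h' : cs.length (cs.simple i * w) = cs.length (w * cs.simple j)) :
    cs.simple i * w = w * cs.simple j := by
  wlog hup : cs.length w < cs.length (cs.simple i * w) generalizing w with H
  · have hlt : cs.length (cs.simple i * w) < cs.length w := by
      have := cs.length_simple_mul_ne w i; omega
    have := H (w := cs.simple i * w) (by
      rw [cs.simple_mul_simple_cancel_left, h']) (by
      rw [cs.simple_mul_simple_cancel_left, h]) (by
      rwa [cs.simple_mul_simple_cancel_left])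
    rw [cs.simple_mul_simple_cancel_left] at this
    have h3 := congrArg (fun x => x * cs.simple j) this
    simpa [mul_assoc] using h3.symm
  let r : Refl cs := ⟨w * cs.simple j * w⁻¹, w, j, rfl⟩
  have h1 : ¬ (canonicalAction cs w⁻¹ (r, 1)).2 = -1 := by
    rw [sign_eq_iff]; simp [r]; omega
  have h2 : (canonicalAction cs (cs.simple i * w)⁻¹ (r.conj (cs.simple i), 1)).2 = -1 := by
    rw [sign_eq_iff]
    have : (r.conj (cs.simple i)).1 * (cs.simple i * w) = cs.simple i * w * cs.simple j := by
      simp [r, Refl.conj, mul_assoc]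
    rw [this, h]; exact hup
  by_contra hne
  have hr : (r.conj (cs.simple i)).1 ≠ cs.simple i := by
    intro hh
    apply hne
    have h3 := congrArg (fun x => x * cs.simple i * w) hh
    simp [r, Refl.conj, mul_assoc] at h3
    simpa using (congrArg (fun x => cs.simple i * x) h3).symm
  have hrr : (r.conj (cs.simple i)).conj (cs.simple i) = r :=
    Subtype.ext (by simp [Refl.conj, mul_assoc])
  rw [mul_inv_rev, cs.inv_simple, map_mul, Equiv.Perm.mul_apply, canonicalAction_simple,
    simpleStep, if_neg hr, hrr] at h2
  exact h1 h2

end CoxeterSystem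


/-- An extended Coxeter group: a group `W` with subgroups `aff` and `Ω`, a subset `S` and a
homomorphism `proj : W → Ω` such that `1 → aff → W → Ω → 1` is exact and split by the inclusion
of `Ω`, `(aff, S)` is a Coxeter group, and conjugation by `Ω` preserves `S`. -/
structure ExtendedCoxeterGroup (W : Type*) [Group W] where
  aff : Subgroup W
  Ω : Subgroup W
  S : Set W
  proj : W →* Ω
  ker_proj : proj.ker = aff
  proj_coe : ∀ u : Ω, proj u = u
  M : CoxeterMatrix S
  cs : CoxeterSystem M aff
  simple_coe : ∀ s : S, (cs.simple s : W) = s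
  conj_mem : ∀ u ∈ Ω, ∀ s ∈ S, u * s * u⁻¹ ∈ S

namespace ExtendedCoxeterGroup

variable {W : Type*} [Group W] (E : ExtendedCoxeterGroup W)

/-- The action `u(s) = u s u⁻¹` of `Ω` on `S`. -/
def act (u : E.Ω) (s : E.S) : E.S := ⟨u * s * (u : W)⁻¹, E.conj_mem u u.2 s s.2⟩

theorem affPart_mem (w : W) : w * (E.proj w : W)⁻¹ ∈ E.aff := by
  rw [← E.ker_proj, MonoidHom.mem_ker, map_mul, ← Subgroup.coe_inv, E.proj_coe, mul_inv_cancel]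

/-- The component `w' ∈ aff` of `w = w' u`, `u ∈ Ω`; this is `w` viewed as a chamber. -/
def affPart (w : W) : E.aff := ⟨w * (E.proj w : W)⁻¹, E.affPart_mem w⟩

/-- The length function on `W`, `ℓ(w' u) = ℓ(w')` for `w' ∈ aff` and `u ∈ Ω`. -/
noncomputable def len (w : W) : ℕ := E.cs.length (E.affPart w)

/-- The set `ℌ` of walls (hyperplanes). -/
abbrev Wall := Refl E.cs

/-- The wall `s`, for `s ∈ S`. -/
def simpleWall (s : E.S) : E.Wall := ⟨E.cs.simple s, E.cs.isReflection_simple s⟩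

/-- The wall `H` separates the elements `w₁`, `w₂` of `W`, viewed as chambers. -/
def Separates (H : E.Wall) (w₁ w₂ : W) : Prop :=
  ProP.Separates E.cs H (E.affPart w₁) (E.affPart w₂)

theorem proj_aff (x : E.aff) : E.proj x = 1 := by
  have h : (x : W) ∈ E.proj.ker := by rw [E.ker_proj]; exact x.2
  exact h

theorem proj_simple (s : E.S) : E.proj (s : W) = 1 := by
  rw [← E.simple_coe, E.proj_aff]

theorem affPart_mul_proj (w : W) : (E.affPart w : W) * E.proj w = w := by simp [affPart]

theorem affPart_one : E.affPart 1 = 1 := Subtype.ext (by simp [affPart])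

theorem separates_one_finite (w : W) : {H : E.Wall | E.Separates H 1 w}.Finite := by
  simp only [Separates, affPart_one]
  exact ProP.separates_one_finite E.cs _

theorem affPart_simple_mul (s : E.S) (w : W) :
    E.affPart (s * w) = E.cs.simple s * E.affPart w := by
  refine Subtype.ext ?_
  simp [affPart, E.proj_simple, E.simple_coe, mul_assoc]

theorem affPart_mul_simple (w : W) (s : E.S) :
    E.affPart (w * s) = E.affPart w * E.cs.simple (E.act (E.proj w) s) := by
  refine Subtype.ext ?_
  simp [affPart, E.proj_simple, E.simple_coe, mul_assoc, act]

theorem affPart_mul_unit (w : W) (u : E.Ω) : E.affPart (w * u) = E.affPart w := by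
  refine Subtype.ext ?_
  simp [affPart, E.proj_coe, mul_assoc]

theorem len_conj_le (u : E.Ω) (x y : E.aff) (h : (y : W) = u * x * (u : W)⁻¹) :
    E.cs.length y ≤ E.cs.length x := by
  obtain ⟨l, hl, rfl⟩ := E.cs.exists_isReduced x
  have : y = E.cs.wordProd (l.map (E.act u)) := by
    refine Subtype.ext ?_
    rw [h]
    clear h hl
    induction l with
    | nil => simp
    | cons s l ih =>
      rw [E.cs.wordProd_cons, List.map_cons, E.cs.wordProd_cons, Subgroup.coe_mul,
        Subgroup.coe_mul, ← ih, E.simple_coe, E.simple_coe]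
      simp [act, mul_assoc]
  rw [this, hl.eq]
  simpa using E.cs.length_wordProd_le (l.map (E.act u))

theorem len_mul_unit (w : W) {u : W} (hu : u ∈ E.Ω) : E.len (w * u) = E.len w := by
  rw [len, E.affPart_mul_unit w ⟨u, hu⟩, len]

theorem len_unit_mul (w : W) {u : W} (hu : u ∈ E.Ω) : E.len (u * w) = E.len w := by
  have h : ((E.affPart (u * w) : E.aff) : W) = u * E.affPart w * u⁻¹ := by
    have h1 : E.proj u = ⟨u, hu⟩ := E.proj_coe ⟨u, hu⟩
    simp [affPart, h1, mul_assoc]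
  apply le_antisymm
  · exact E.len_conj_le ⟨u, hu⟩ _ _ h
  · exact E.len_conj_le ⟨u⁻¹, inv_mem hu⟩ _ _ (by simp [h, mul_assoc])

theorem len_mul_le (w w' : W) : E.len (w * w') ≤ E.len w + E.len w' := by
  have h : E.affPart (w * w') =
      E.affPart w * E.affPart (E.proj w * w') := by
    refine Subtype.ext ?_
    simp [affPart, E.proj_coe, mul_assoc]
  have h2 := E.len_unit_mul w' (E.proj w).2
  rw [len] at h2
  rw [len, h, ← h2]
  exact E.cs.length_mul_le _ _

theorem len_eq_zero_iff (w : W) : E.len w = 0 ↔ w ∈ E.Ω := by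
  rw [len, E.cs.length_eq_zero_iff]
  constructor
  · intro h
    rw [← E.affPart_mul_proj w, h]; simp
  · intro h
    have h1 : E.proj w = ⟨w, h⟩ := E.proj_coe ⟨w, h⟩
    exact Subtype.ext (by simp [affPart, h1])

theorem len_simple_mul (s : E.S) (w : W) :
    E.len (s * w) = E.len w + 1 ∨ E.len (s * w) + 1 = E.len w := by
  rw [len, affPart_simple_mul]; exact E.cs.length_simple_mul _ _

theorem len_mul_simple (w : W) (s : E.S) :
    E.len (w * s) = E.len w + 1 ∨ E.len (w * s) + 1 = E.len w := by
  rw [len, affPart_mul_simple]; exact E.cs.length_mul_simple _ _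

theorem simple_mul_self (s : E.S) : (s : W) * s = 1 := by
  rw [← E.simple_coe, ← Subgroup.coe_mul, E.cs.simple_mul_simple_self, Subgroup.coe_one]

theorem exists_left_descent {w : W} (h : E.len w ≠ 0) : ∃ s : E.S, E.len (s * w) + 1 = E.len w := by
  have h1 : E.affPart w ≠ 1 := by
    intro h1; rw [len, h1, E.cs.length_one] at h; exact h rfl
  obtain ⟨s, hs⟩ := E.cs.exists_leftDescent_of_ne_one h1
  refine ⟨s, ?_⟩
  have := E.len_simple_mul s w
  have h2 : E.len (s * w) < E.len w := by rw [len, affPart_simple_mul]; exact hs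
  omega

theorem exists_right_descent {w : W} (h : E.len w ≠ 0) :
    ∃ s : E.S, E.len (w * s) + 1 = E.len w := by
  have h1 : E.affPart w ≠ 1 := by
    intro h1; rw [len, h1, E.cs.length_one] at h; exact h rfl
  obtain ⟨s, hs⟩ := E.cs.exists_rightDescent_of_ne_one h1
  have h3 : E.act (E.proj w) (E.act (E.proj w)⁻¹ s) = s :=
    Subtype.ext (by simp [act, mul_assoc])
  refine ⟨E.act (E.proj w)⁻¹ s, ?_⟩
  have := E.len_mul_simple w (E.act (E.proj w)⁻¹ s)
  have h2 : E.len (w * (E.act (E.proj w)⁻¹ s : E.S)) < E.len w := by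
    rw [len, affPart_mul_simple, h3]; exact hs
  omega

theorem simple_mul_eq_mul_simple {w : W} {s t : E.S}
    (h : E.len (s * w * t) = E.len w) (h' : E.len (s * w) = E.len (w * t)) :
    (s : W) * w = w * t := by
  have hp : E.proj ((s : W) * w) = E.proj w := by rw [map_mul, E.proj_simple, one_mul]
  rw [len, len, affPart_mul_simple, affPart_simple_mul, hp] at h
  rw [len, len, affPart_mul_simple, affPart_simple_mul] at h'
  have := congrArg (fun x : E.aff => (x : W) * E.proj w) (ProP.simple_mul_eq_mul_simple E.cs h h')
  simp only [Subgroup.coe_mul, E.simple_coe, mul_assoc] at this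
  rw [E.affPart_mul_proj] at this
  rw [this]
  simp [act, affPart, mul_assoc]

end ExtendedCoxeterGroup

/-- The alternating product `a b a ⋯` with `m` factors. -/
def altProd {G : Type*} [Monoid G] (a b : G) : ℕ → G
  | 0 => 1
  | m + 1 => a * altProd b a m

/-- A pro-`p` Coxeter group: an extension `1 → T → G → W → 1` of an extended Coxeter group `W` by
an abelian group `T = ker π`, with lifts `n s ∈ G` of the `s ∈ S` which satisfy the braid relations
`n s * n t * n s ⋯ = n t * n s * n t ⋯` (`m(s,t)` factors) whenever the order `m(s,t)` of `s t` is
finite. -/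
structure ProPCoxeterGroup (G W : Type*) [Group G] [Group W] extends ExtendedCoxeterGroup W where
  π : G →* W
  π_surjective : Function.Surjective π
  T_comm : ∀ t ∈ π.ker, ∀ t' ∈ π.ker, t * t' = t' * t
  n : S → G
  π_n : ∀ s : S, π (n s) = s
  braid : ∀ s t : S, orderOf (s * t : W) ≠ 0 →
    altProd (n s) (n t) (orderOf (s * t : W)) = altProd (n t) (n s) (orderOf (s * t : W))

namespace ProPCoxeterGroup

variable {G W : Type*} [Group G] [Group W] (P : ProPCoxeterGroup G W)

/-- The abelian normal subgroup `T` of `G`. -/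
abbrev T : Subgroup G := P.π.ker

/-- The subgroup of elements of `G` of length zero, the preimage of `Ω`. -/
abbrev Ω₁ : Subgroup G := P.Ω.comap P.π

/-- The length function on `G`. -/
noncomputable def length (g : G) : ℕ := P.len (P.π g)

theorem length_mul_unit (g : G) {u : G} (hu : u ∈ P.Ω₁) : P.length (g * u) = P.length g := by
  rw [length, map_mul, P.len_mul_unit _ hu, length]

theorem length_unit_mul (g : G) {u : G} (hu : u ∈ P.Ω₁) : P.length (u * g) = P.length g := by
  rw [length, map_mul, P.len_unit_mul _ hu, length]

theorem length_eq_zero_iff (g : G) : P.length g = 0 ↔ g ∈ P.Ω₁ := P.len_eq_zero_iff _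

theorem T_le : P.T ≤ P.Ω₁ := by
  intro t ht
  rw [Subgroup.mem_comap, (MonoidHom.mem_ker).1 ht]
  exact one_mem _

theorem length_n_mul (s : P.S) (g : G) :
    P.length (P.n s * g) = P.length g + 1 ∨ P.length (P.n s * g) + 1 = P.length g := by
  rw [length, map_mul, P.π_n]; exact P.len_simple_mul _ _

theorem length_mul_n (g : G) (s : P.S) :
    P.length (g * P.n s) = P.length g + 1 ∨ P.length (g * P.n s) + 1 = P.length g := by
  rw [length, map_mul, P.π_n]; exact P.len_mul_simple _ _

theorem π_n_inv (s : P.S) : (P.π (P.n s))⁻¹ = s := by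
  rw [P.π_n, inv_eq_iff_mul_eq_one, P.simple_mul_self]

theorem exists_left_factor {g : G} (h : P.length g ≠ 0) :
    ∃ (s : P.S) (g' : G), g = P.n s * g' ∧ P.length g = P.length g' + 1 := by
  obtain ⟨s, hs⟩ := P.exists_left_descent h
  refine ⟨s, (P.n s)⁻¹ * g, by simp, ?_⟩
  rw [length, length, map_mul, map_inv, π_n_inv, hs]

theorem exists_right_factor {g : G} (h : P.length g ≠ 0) :
    ∃ (g' : G) (s : P.S), g = g' * P.n s ∧ P.length g = P.length g' + 1 := by
  obtain ⟨s, hs⟩ := P.exists_right_descent h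
  refine ⟨g * (P.n s)⁻¹, s, by simp, ?_⟩
  rw [length, length, map_mul, map_inv, π_n_inv, hs]

theorem simple_mul_π_eq {g : G} {s t : P.S}
    (h : P.length (P.n s * g * P.n t) = P.length g)
    (h' : P.length (P.n s * g) = P.length (g * P.n t)) : (s : W) * P.π g = P.π g * t := by
  apply P.toExtendedCoxeterGroup.simple_mul_eq_mul_simple
  · simpa [length, P.π_n] using h
  · simpa [length, P.π_n] using h'

theorem twist_mem {s t : P.S} {g : G} (h : (s : W) * P.π g = P.π g * t) :
    P.n s * g * (P.n t)⁻¹ * g⁻¹ ∈ P.T := by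
  rw [MonoidHom.mem_ker]
  simp only [map_mul, map_inv, P.π_n]
  rw [h]; simp

theorem exists_reduced (g : G) : ∃ (l : List P.S) (u : G),
    u ∈ P.Ω₁ ∧ g = (l.map P.n).prod * u ∧ P.length g = l.length := by
  induction h : P.length g generalizing g with
  | zero => exact ⟨[], g, (P.length_eq_zero_iff g).1 h, by simp, rfl⟩
  | succ k ih =>
    obtain ⟨s, g', rfl, hg'⟩ := P.exists_left_factor (g := g) (by omega)
    obtain ⟨l, u, hu, hl, hk⟩ := ih g' (by omega)
    exact ⟨s :: l, u, hu, by rw [List.map_cons, List.prod_cons, mul_assoc, ← hl], by simp [← hk]⟩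

/-- The action of `g ∈ G` on the group algebra `R[T]` induced by `t ↦ g t g⁻¹`. -/
noncomputable def actT (R : Type*) [CommRing R] (g : G) :
    MonoidAlgebra R P.T →ₐ[R] MonoidAlgebra R P.T :=
  MonoidAlgebra.mapDomainAlgHom R R (MulAut.conjNormal g : P.T ≃* P.T).toMonoidHom

end ProPCoxeterGroup

/-- Parameters `a s ∈ R`, `b s ∈ R[T]` of a generic pro-`p` Hecke algebra: if `s π(g) = π(g) t`,
then `a s = a t` and `(n_s g n_t⁻¹ g⁻¹) g(b_t) = b_s`. -/
structure HeckeParam {G W : Type*} [Group G] [Group W] (P : ProPCoxeterGroup G W)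
    (R : Type*) [CommRing R] where
  a : P.S → R
  b : P.S → MonoidAlgebra R P.T
  a_eq : ∀ (s t : P.S) (g : G), (s : W) * P.π g = P.π g * t → a s = a t
  b_eq : ∀ (s t : P.S) (g : G) (h : (s : W) * P.π g = P.π g * t),
    MonoidAlgebra.single (⟨P.n s * g * (P.n t)⁻¹ * g⁻¹, P.twist_mem h⟩ : P.T) (1 : R) *
      P.actT R g (b t) = b s

namespace HeckeParam

variable {G W : Type*} [Group G] [Group W] {P : ProPCoxeterGroup G W}
  {R : Type*} [CommRing R] (D : HeckeParam P R)

/-- The basis element `g` of the free module on `G`; the group algebra `R[G]` is used as this free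
module, so that its multiplication gives the natural bimodule structure over `R[Ω₁]`. -/
noncomputable def e (R : Type*) [CommRing R] (g : G) : MonoidAlgebra R G :=
  MonoidAlgebra.single g 1

/-- The inclusion `R[T] → R[G]`. -/
noncomputable def incl (P : ProPCoxeterGroup G W) (R : Type*) [CommRing R] :
    MonoidAlgebra R P.T →ₐ[R] MonoidAlgebra R G :=
  MonoidAlgebra.mapDomainAlgHom R R P.T.subtype

open Classical in
/-- The operator on the free module which is left multiplication by `T_{n_s}`. -/
noncomputable def lmul (s : P.S) : Module.End R (MonoidAlgebra R G) :=
  (MonoidAlgebra.basis G R).constr R fun g =>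
    if P.length (P.n s * g) = P.length g + 1 then e R (P.n s * g)
    else D.a s • e R (P.n s * g) + incl P R (D.b s) * e R g

open Classical in
/-- The operator on the free module which is right multiplication by `T_{n_s}`. -/
noncomputable def rmul (s : P.S) : Module.End R (MonoidAlgebra R G) :=
  (MonoidAlgebra.basis G R).constr R fun g =>
    if P.length (g * P.n s) = P.length g + 1 then e R (g * P.n s)
    else D.a s • e R (g * P.n s) + e R g * incl P R (D.b s)

theorem e_mul (g h : G) : e R g * e R h = e R (g * h) := by simp [e]

theorem e_one : e R (1 : G) = 1 := rfl

theorem end_ext {V : Type*} [AddCommMonoid V] [Module R V] {f f' : MonoidAlgebra R G →ₗ[R] V}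
    (h : ∀ g, f (e R g) = f' (e R g)) : f = f' :=
  (MonoidAlgebra.basis G R).ext (by simpa [e] using h)

theorem incl_single (t : P.T) (r : R) : incl P R (MonoidAlgebra.single t r) = r • e R (t : G) := by
  simp [incl, e]

theorem e_mul_incl (g : G) (c : MonoidAlgebra R P.T) :
    e R g * incl P R c = incl P R (P.actT R g c) * e R g := by
  induction c using MonoidAlgebra.induction_linear with
  | zero => simp
  | add x y hx hy => simp [mul_add, add_mul, hx, hy]
  | single t r =>
    have : P.actT R g (MonoidAlgebra.single t r) =
        MonoidAlgebra.single (MulAut.conjNormal g t) r := by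
      simp [ProPCoxeterGroup.actT]
    rw [this, incl_single, incl_single, mul_smul_comm, smul_mul_assoc, e_mul, e_mul,
      MulAut.conjNormal_apply]
    simp

theorem b_shift {s t : P.S} {g : G} (h : (s : W) * P.π g = P.π g * t) :
    incl P R (D.b s) * e R g = e R (P.n s * g * (P.n t)⁻¹) * incl P R (D.b t) := by
  rw [← D.b_eq s t g h, map_mul, incl_single, one_smul, mul_assoc, ← e_mul_incl, ← mul_assoc, e_mul]
  simp

theorem b_comm (s : P.S) :
    e R (P.n s) * incl P R (D.b s) = incl P R (D.b s) * e R (P.n s) := by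
  have := D.b_shift (s := s) (t := s) (g := P.n s) (by rw [P.π_n])
  rw [this]; simp

theorem b_swap {s t : P.S} {g : G} (h : (s : W) * P.π g = P.π g * t) :
    incl P R (D.b s) * e R (g * P.n t) = e R (P.n s * g) * incl P R (D.b t) := by
  rw [← e_mul, ← mul_assoc, D.b_shift h, mul_assoc, ← D.b_comm, ← mul_assoc, e_mul]
  simp

theorem lmul_up {s : P.S} {g : G} (h : P.length (P.n s * g) = P.length g + 1) :
    D.lmul s (e R g) = e R (P.n s * g) := by
  rw [lmul, e, ← MonoidAlgebra.basis_apply, Module.Basis.constr_basis, if_pos h]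

theorem lmul_down {s : P.S} {g : G} (h : P.length (P.n s * g) + 1 = P.length g) :
    D.lmul s (e R g) = D.a s • e R (P.n s * g) + incl P R (D.b s) * e R g := by
  conv_lhs => rw [lmul, e, ← MonoidAlgebra.basis_apply]
  rw [Module.Basis.constr_basis, if_neg (by omega)]

theorem rmul_up {s : P.S} {g : G} (h : P.length (g * P.n s) = P.length g + 1) :
    D.rmul s (e R g) = e R (g * P.n s) := by
  rw [rmul, e, ← MonoidAlgebra.basis_apply, Module.Basis.constr_basis, if_pos h]

theorem rmul_down {s : P.S} {g : G} (h : P.length (g * P.n s) + 1 = P.length g) :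
    D.rmul s (e R g) = D.a s • e R (g * P.n s) + e R g * incl P R (D.b s) := by
  conv_lhs => rw [rmul, e, ← MonoidAlgebra.basis_apply]
  rw [Module.Basis.constr_basis, if_neg (by omega)]

theorem lmul_mul_unit (s : P.S) (x : MonoidAlgebra R G) {u : G} (hu : u ∈ P.Ω₁) :
    D.lmul s (x * e R u) = D.lmul s x * e R u := by
  suffices h : D.lmul s ∘ₗ LinearMap.mulRight R (e R u) =
      LinearMap.mulRight R (e R u) ∘ₗ D.lmul s from LinearMap.congr_fun h x
  refine end_ext fun g => ?_
  simp only [LinearMap.comp_apply, LinearMap.mulRight_apply, e_mul]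
  have h1 : P.length (P.n s * (g * u)) = P.length (P.n s * g) := by
    rw [← mul_assoc, P.length_mul_unit _ hu]
  have h2 := P.length_mul_unit g hu
  rcases P.length_n_mul s g with h | h
  · rw [D.lmul_up h, D.lmul_up (by rw [h1, h2, h]), e_mul, mul_assoc]
  · rw [D.lmul_down h, D.lmul_down (by rw [h1, h2, h]), add_mul, smul_mul_assoc, mul_assoc,
      e_mul, e_mul, mul_assoc]

theorem rmul_unit_mul (s : P.S) (x : MonoidAlgebra R G) {u : G} (hu : u ∈ P.Ω₁) :
    D.rmul s (e R u * x) = e R u * D.rmul s x := by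
  suffices h : D.rmul s ∘ₗ LinearMap.mulLeft R (e R u) =
      LinearMap.mulLeft R (e R u) ∘ₗ D.rmul s from LinearMap.congr_fun h x
  refine end_ext fun g => ?_
  simp only [LinearMap.comp_apply, LinearMap.mulLeft_apply, e_mul]
  have h1 : P.length (u * g * P.n s) = P.length (g * P.n s) := by
    rw [mul_assoc, P.length_unit_mul _ hu]
  have h2 := P.length_unit_mul g hu
  rcases P.length_mul_n g s with h | h
  · rw [D.rmul_up h, D.rmul_up (by rw [h1, h2, h]), e_mul, mul_assoc]
  · rw [D.rmul_down h, D.rmul_down (by rw [h1, h2, h]), mul_add, mul_smul_comm, ← mul_assoc,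
      e_mul, e_mul, ← mul_assoc]

theorem lmul_mul_incl (s : P.S) (x : MonoidAlgebra R G) (c : MonoidAlgebra R P.T) :
    D.lmul s (x * incl P R c) = D.lmul s x * incl P R c := by
  induction c using MonoidAlgebra.induction_linear with
  | zero => simp
  | add y z hy hz => simp only [map_add, mul_add, hy, hz]
  | single t r =>
    rw [incl_single, mul_smul_comm, map_smul, D.lmul_mul_unit s x (P.T_le t.2), mul_smul_comm]

theorem rmul_incl_mul (s : P.S) (x : MonoidAlgebra R G) (c : MonoidAlgebra R P.T) :
    D.rmul s (incl P R c * x) = incl P R c * D.rmul s x := by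
  induction c using MonoidAlgebra.induction_linear with
  | zero => simp
  | add y z hy hz => simp only [map_add, add_mul, hy, hz]
  | single t r =>
    rw [incl_single, smul_mul_assoc, map_smul, D.rmul_unit_mul s x (P.T_le t.2), smul_mul_assoc]

theorem lmul_rmul (s t : P.S) (x : MonoidAlgebra R G) :
    D.lmul s (D.rmul t x) = D.rmul t (D.lmul s x) := by
  suffices h : D.lmul s ∘ₗ D.rmul t = D.rmul t ∘ₗ D.lmul s from LinearMap.congr_fun h x
  refine end_ext fun g => ?_
  simp only [LinearMap.comp_apply]
  have hl := P.length_n_mul s g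
  have hr := P.length_mul_n g t
  have hlr := P.length_n_mul s (g * P.n t)
  have hrl := P.length_mul_n (P.n s * g) t
  have key : P.length (P.n s * g * P.n t) = P.length g →
      P.length (P.n s * g) = P.length (g * P.n t) →
      D.a s = D.a t ∧
        incl P R (D.b s) * e R (g * P.n t) = e R (P.n s * g) * incl P R (D.b t) := by
    intro h h'
    have := P.simple_mul_π_eq h h'
    exact ⟨D.a_eq s t g this, D.b_swap this⟩
  rw [← mul_assoc] at hlr
  have assoc : P.n s * (g * P.n t) = P.n s * g * P.n t := (mul_assoc _ _ _).symm
  rcases hl with hl | hl <;> rcases hr with hr | hr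
  · rw [D.lmul_up hl, D.rmul_up hr]
    rcases hlr with hlr | hlr
    · rw [D.lmul_up (by rw [assoc]; exact hlr), D.rmul_up (by omega), assoc]
    · rw [D.lmul_down (by rw [assoc]; exact hlr), D.rmul_down (by omega), assoc]
      obtain ⟨h1, h2⟩ := key (by omega) (by omega)
      rw [h1, h2]
  · rw [D.lmul_up hl, D.rmul_down hr, D.rmul_down (by omega), map_add, map_smul,
      D.lmul_mul_incl, D.lmul_up hl, D.lmul_up (by rw [assoc]; omega), assoc]
  · rw [D.lmul_down hl, D.rmul_up hr, D.lmul_down (by rw [assoc]; omega), map_add, map_smul,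
      D.rmul_incl_mul, D.rmul_up hr, D.rmul_up (by omega), assoc]
  · rw [D.lmul_down hl, D.rmul_down hr, map_add, map_add, map_smul, map_smul, D.lmul_mul_incl,
      D.rmul_incl_mul, D.lmul_down hl, D.rmul_down hr]
    rcases hlr with hlr | hlr
    · rw [D.lmul_up (by rw [assoc]; exact hlr), D.rmul_up (by omega), assoc]
      obtain ⟨h1, h2⟩ := key (by omega) (by omega)
      rw [mul_add, add_mul, mul_smul_comm, smul_mul_assoc, h1, h2]
      simp only [mul_assoc]
    · rw [D.lmul_down (by rw [assoc]; exact hlr), D.rmul_down (by omega), assoc]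
      simp only [mul_add, add_mul, mul_smul_comm, smul_mul_assoc, smul_add, mul_assoc,
        smul_comm (D.a t) (D.a s)]
      abel

/-- The algebra of operators on the free module with basis `G` generated by the left
multiplications by `T_{n_s}`, `s ∈ S`, and by `T_u`, `u ∈ Ω₁`. -/
noncomputable def operators : Subalgebra R (Module.End R (MonoidAlgebra R G)) :=
  Algebra.adjoin R (Set.range D.lmul ∪ {f | ∃ u ∈ P.Ω₁, f = LinearMap.mulLeft R (e R u)})

/-- The generic pro-`p` Hecke algebra for the parameters `a`, `b`, constructed as an algebra of
operators on the free `R`-module on `G`. It is free with basis `T` (see below). -/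
def Hecke : Type _ := ↥D.operators

noncomputable instance : Ring D.Hecke := inferInstanceAs (Ring ↥D.operators)

noncomputable instance : Algebra R D.Hecke := inferInstanceAs (Algebra R ↥D.operators)

theorem operators_comm_rmul {f : Module.End R (MonoidAlgebra R G)} (hf : f ∈ D.operators)
    (s : P.S) (x : MonoidAlgebra R G) : f (D.rmul s x) = D.rmul s (f x) := by
  have h : D.operators ≤ Subalgebra.centralizer R {D.rmul s} := by
    refine Algebra.adjoin_le ?_
    rintro _ (⟨t, rfl⟩ | ⟨u, hu, rfl⟩) _ rfl
    · exact LinearMap.ext fun x => (D.lmul_rmul t s x).symm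
    · exact LinearMap.ext fun x => D.rmul_unit_mul s x hu
  exact (LinearMap.congr_fun (h hf _ rfl) x).symm

theorem operators_comm_unit {f : Module.End R (MonoidAlgebra R G)} (hf : f ∈ D.operators)
    {u : G} (hu : u ∈ P.Ω₁) (x : MonoidAlgebra R G) : f (x * e R u) = f x * e R u := by
  have h : D.operators ≤ Subalgebra.centralizer R {LinearMap.mulRight R (e R u)} := by
    refine Algebra.adjoin_le ?_
    rintro _ (⟨t, rfl⟩ | ⟨v, hv, rfl⟩) _ rfl
    · exact LinearMap.ext fun x => (D.lmul_mul_unit t x hu).symm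
    · exact LinearMap.ext fun x => by simp [mul_assoc]
  exact (LinearMap.congr_fun (h hf _ rfl) x).symm

theorem lmul_mem (s : P.S) : D.lmul s ∈ D.operators :=
  Algebra.subset_adjoin (Or.inl ⟨s, rfl⟩)

theorem mulLeft_mem {u : G} (hu : u ∈ P.Ω₁) : LinearMap.mulLeft R (e R u) ∈ D.operators :=
  Algebra.subset_adjoin (Or.inr ⟨u, hu, rfl⟩)

/-- Evaluation of operators at the basis element `1`. -/
noncomputable def evalOne : D.Hecke →ₗ[R] MonoidAlgebra R G where
  toFun f := f.1 (e R 1)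
  map_add' _ _ := rfl
  map_smul' _ _ := rfl

theorem evalOne_injective : Function.Injective D.evalOne := by
  refine (injective_iff_map_eq_zero D.evalOne).2 ?_
  rintro ⟨f, hf⟩ h
  have h0 : f (e R 1) = 0 := h
  refine Subtype.ext (end_ext fun g => ?_)
  change f (e R g) = 0
  induction hk : P.length g generalizing g with
  | zero =>
    have hg := (P.length_eq_zero_iff g).1 hk
    have := D.operators_comm_unit hf hg (e R 1)
    rwa [h0, zero_mul, e_mul, one_mul] at this
  | succ k ih =>
    obtain ⟨g', s, rfl, hg'⟩ := P.exists_right_factor (g := g) (by omega)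
    have := D.operators_comm_rmul hf s (e R g')
    rwa [D.rmul_up hg', ih g' (by omega), map_zero] at this

theorem exists_operator (g : G) : ∃ f : D.Hecke, D.evalOne f = e R g := by
  induction hk : P.length g generalizing g with
  | zero =>
    refine ⟨⟨_, D.mulLeft_mem ((P.length_eq_zero_iff g).1 hk)⟩, ?_⟩
    change e R g * e R 1 = _
    rw [e_mul, mul_one]
  | succ k ih =>
    obtain ⟨s, g', rfl, hg'⟩ := P.exists_left_factor (g := g) (by omega)
    obtain ⟨f, hf⟩ := ih g' (by omega)
    refine ⟨⟨_, D.lmul_mem s⟩ * f, ?_⟩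
    change D.lmul s (f.1 (e R 1)) = _
    rw [show f.1 (e R 1) = e R g' from hf, D.lmul_up hg']

theorem evalOne_surjective : Function.Surjective D.evalOne := by
  rw [← LinearMap.range_eq_top, eq_top_iff, ← (MonoidAlgebra.basis G R).span_eq, Submodule.span_le]
  rintro _ ⟨g, rfl⟩
  obtain ⟨f, hf⟩ := D.exists_operator g
  exact ⟨f, hf⟩

/-- The Hecke algebra is free as an `R`-module: evaluation at `1` identifies it with the free
module on `G`. -/
noncomputable def evalEquiv : D.Hecke ≃ₗ[R] MonoidAlgebra R G :=
  LinearEquiv.ofBijective D.evalOne ⟨D.evalOne_injective, D.evalOne_surjective⟩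

/-- The canonical basis `(T_g)_{g ∈ G}` of the Hecke algebra. -/
noncomputable def T : Module.Basis G R D.Hecke := (MonoidAlgebra.basis G R).map D.evalEquiv.symm

/-- The canonical map `R[T] → Hecke`, `t ↦ T_t`. -/
noncomputable def ofT : MonoidAlgebra R P.T →ₗ[R] D.Hecke :=
  (MonoidAlgebra.basis P.T R).constr R fun t => D.T (t : G)

theorem evalOne_T (g : G) : D.evalOne (D.T g) = e R g := by
  rw [T, Module.Basis.map_apply, MonoidAlgebra.basis_apply]
  exact D.evalEquiv.apply_symm_apply _

theorem T_unit {u : G} (hu : u ∈ P.Ω₁) : D.T u = ⟨_, D.mulLeft_mem hu⟩ := by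
  apply D.evalOne_injective
  rw [evalOne_T]
  change _ = e R u * e R 1
  rw [e_mul, mul_one]

theorem T_n_mul {s : P.S} {g : G} (h : P.length (P.n s * g) = P.length g + 1) :
    D.T (P.n s * g) = ⟨_, D.lmul_mem s⟩ * D.T g := by
  apply D.evalOne_injective
  rw [evalOne_T]
  change _ = D.lmul s (D.evalOne (D.T g))
  rw [evalOne_T, D.lmul_up h]

theorem evalOne_T_mul {g h : G} (hl : P.length (g * h) = P.length g + P.length h) :
    D.evalOne (D.T g * D.T h) = e R (g * h) := by
  change (D.T g).1 (D.evalOne (D.T h)) = _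
  rw [evalOne_T]
  induction hk : P.length g generalizing g with
  | zero =>
    rw [D.T_unit ((P.length_eq_zero_iff g).1 hk)]
    exact e_mul _ _
  | succ k ih =>
    obtain ⟨s, g', rfl, hg'⟩ := P.exists_left_factor (g := g) (by omega)
    have h1 := P.length_n_mul s (g' * h)
    rw [← mul_assoc] at h1
    have h2 : P.length (g' * h) ≤ P.length g' + P.length h := by
      simp only [ProPCoxeterGroup.length, map_mul]
      exact P.len_mul_le _ _
    rw [D.T_n_mul hg']
    change D.lmul s ((D.T g').1 (e R h)) = _
    rw [ih (by omega) (by omega), D.lmul_up (by rw [← mul_assoc]; omega), mul_assoc]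

/-- `T_{g h} = T_g T_h` if `ℓ(g h) = ℓ(g) + ℓ(h)`. -/
theorem T_mul_T {g h : G} (hl : P.length (g * h) = P.length g + P.length h) :
    D.T (g * h) = D.T g * D.T h :=
  D.evalOne_injective (by rw [D.evalOne_T_mul hl, evalOne_T])

theorem evalOne_ofT (c : MonoidAlgebra R P.T) : D.evalOne (D.ofT c) = incl P R c := by
  suffices h : D.evalOne ∘ₗ D.ofT = (incl P R).toLinearMap from LinearMap.congr_fun h c
  refine (MonoidAlgebra.basis P.T R).ext fun t => ?_
  rw [LinearMap.comp_apply, ofT, Module.Basis.constr_basis, evalOne_T]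
  simp [incl_single]

theorem T_n (s : P.S) : D.T (P.n s) = ⟨_, D.lmul_mem s⟩ := by
  have h1 : P.length (1 : G) = 0 := (P.length_eq_zero_iff 1).2 (one_mem _)
  have h2 := P.length_n_mul s 1
  rw [mul_one] at h2
  apply D.evalOne_injective
  rw [evalOne_T]
  change _ = D.lmul s (e R 1)
  rw [D.lmul_up (by rw [mul_one]; omega), mul_one]

/-- `T_{n_s}² = a_s T_{n_s²} + T_{n_s} b_s`. -/
theorem T_n_mul_T_n (s : P.S) :
    D.T (P.n s) * D.T (P.n s) = D.a s • D.T (P.n s * P.n s) + D.T (P.n s) * D.ofT (D.b s) := by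
  have h1 : P.length (1 : G) = 0 := (P.length_eq_zero_iff 1).2 (one_mem _)
  have h2 : P.length (P.n s * P.n s) = 0 := by
    rw [P.length_eq_zero_iff, Subgroup.mem_comap, map_mul, P.π_n, P.simple_mul_self]
    exact one_mem _
  have h3 : P.length (P.n s) = 1 := by
    have := P.length_n_mul s 1
    rw [mul_one] at this
    omega
  have h4 : ∀ x, D.evalOne (D.T (P.n s) * x) = D.lmul s (D.evalOne x) := by
    intro x; rw [T_n]; rfl
  refine D.evalOne_injective ?_
  rw [LinearMap.map_add, LinearMap.map_smul, h4, h4, evalOne_T, evalOne_T, evalOne_ofT,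
    D.lmul_down (by omega), ← D.b_comm]
  have h5 := D.lmul_mul_incl s (e R 1) (D.b s)
  rw [D.lmul_up (by rw [mul_one]; omega), mul_one, e_one, one_mul] at h5
  rw [h5]

end HeckeParam


/-- An orientation of the Coxeter group `(aff, S)`. The second condition says that, for
`m = m(s,t) < ∞`, the sequences of the signs `o(w,s), o(ws,t), o(wst,s), …` and
`o(w,t), o(wt,s), o(wts,t), …` (`m` terms each) are of the form `(ε,…,ε,-ε,…,-ε)`, with `k` entries
`ε`, and `(-ε,…,-ε,ε,…,ε)`, with `k` entries `ε`. -/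
def ExtendedCoxeterGroup.IsCoxeterOrientation {W : Type*} [Group W] (E : ExtendedCoxeterGroup W)
    (o : E.aff → E.S → ℤˣ) : Prop :=
  (∀ w s, o (w * E.cs.simple s) s = -o w s) ∧
  ∀ (s t : E.S), orderOf (s * t : W) ≠ 0 → ∀ w : E.aff,
    ∃ k ≤ orderOf (s * t : W), ∃ ε : ℤˣ,
      (∀ j < orderOf (s * t : W),
        o (w * altProd (E.cs.simple s) (E.cs.simple t) j) (if Even j then s else t) =
          if j < k then ε else -ε) ∧
      (∀ j < orderOf (s * t : W),
        o (w * altProd (E.cs.simple t) (E.cs.simple s) j) (if Even j then t else s) =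
          if j < orderOf (s * t : W) - k then -ε else ε)

/-- An orientation of the extended Coxeter group `W`: a map of the form
`(w u, s) ↦ o₀(w, u(s))`, `w ∈ aff`, `u ∈ Ω`, for an orientation `o₀` of `(aff, S)`. -/
def ExtendedCoxeterGroup.IsOrientation {W : Type*} [Group W] (E : ExtendedCoxeterGroup W)
    (o : W → E.S → ℤˣ) : Prop :=
  ∃ o₀ : E.aff → E.S → ℤˣ, E.IsCoxeterOrientation o₀ ∧
    ∀ w s, o w s = o₀ (E.affPart w) (E.act (E.proj w) s)

/-- An orientation of the pro-`p` Coxeter group `G`: a map of the form `(g, s) ↦ o₁(π(g), s)` for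
an orientation `o₁` of `W`. -/
structure Orientation {G W : Type*} [Group G] [Group W] (P : ProPCoxeterGroup G W) where
  toFun : G → P.S → ℤˣ
  isOrientation : ∃ o₁ : W → P.S → ℤˣ, P.IsOrientation o₁ ∧ ∀ g s, toFun g s = o₁ (P.π g) s

theorem ExtendedCoxeterGroup.exists_base {W : Type*} [Group W] (E : ExtendedCoxeterGroup W)
    (H : E.Wall) : ∃ (w : W) (s : E.S),
      w * s * w⁻¹ = ((H : E.aff) : W) ∧ ¬ E.Separates H 1 w := by
  have key : ∀ (x : E.aff) (s : E.S), x * E.cs.simple s * x⁻¹ = (H : E.aff) →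
      ¬ E.cs.length (x * E.cs.simple s) < E.cs.length x →
      ∃ (w : W) (s : E.S), w * s * w⁻¹ = ((H : E.aff) : W) ∧ ¬ E.Separates H 1 w := by
    intro x s h hl
    have hx : E.affPart (x : W) = x := Subtype.ext (by simp [affPart, E.proj_aff])
    refine ⟨x, s, ?_, ?_⟩
    · rw [← h, ← E.simple_coe]; rfl
    · rw [Separates, E.affPart_one, hx, separates_one_iff, ← h, inv_mul_cancel_right]
      exact hl
  obtain ⟨x, s, hx⟩ := H.2
  by_cases hl : E.cs.length (x * E.cs.simple s) < E.cs.length x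
  · refine key (x * E.cs.simple s) s ?_ ?_
    · rw [hx]; simp [mul_assoc]
    · rw [mul_assoc, E.cs.simple_mul_simple_self, mul_one]; omega
  · exact key x s hx.symm hl

namespace ProPCoxeterGroup

variable {G W : Type*} [Group G] [Group W] (P : ProPCoxeterGroup G W)

theorem exists_base (H : P.Wall) : ∃ (g : G) (s : P.S),
    P.π g * s * (P.π g)⁻¹ = ((H : P.aff) : W) ∧ ¬ P.Separates H 1 (P.π g) := by
  obtain ⟨w, s, h⟩ := P.toExtendedCoxeterGroup.exists_base H
  obtain ⟨g, rfl⟩ := P.π_surjective w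
  exact ⟨g, s, h⟩

/-- A lift `g ∈ G` of some `w₀ ∈ W` such that `H = w₀ s w₀⁻¹` for some `s ∈ S` and `H` does not
separate `1` and `w₀`. -/
noncomputable def base (H : P.Wall) : G := (P.exists_base H).choose

/-- The `s ∈ S` which belongs to `P.base H`. -/
noncomputable def baseSimple (H : P.Wall) : P.S := (P.exists_base H).choose_spec.choose

theorem base_spec (H : P.Wall) :
    P.π (P.base H) * P.baseSimple H * (P.π (P.base H))⁻¹ = ((H : P.aff) : W) ∧
      ¬ P.Separates H 1 (P.π (P.base H)) :=
  (P.exists_base H).choose_spec.choose_spec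

/-- The finite set of walls which separate `1` and `g`. -/
noncomputable def sepWalls (g : G) : Finset P.Wall :=
  (P.toExtendedCoxeterGroup.separates_one_finite (P.π g)).toFinset

end ProPCoxeterGroup

namespace Orientation

variable {G W : Type*} [Group G] [Group W] {P : ProPCoxeterGroup G W}

/-- The sign `o(g, H) = o(g w₀, s)`, where `H = w₀ s w₀⁻¹` and `1`, `w₀` lie on the same side of
`H`. It does not depend on the choice of `w₀` and `s`. -/
noncomputable def wallSign (o : Orientation P) (g : G) (H : P.Wall) : ℤˣ :=
  o.toFun (g * P.base H) (P.baseSimple H)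

/-- The orientations `o`, `o'` disagree at `H`: they attach different signs to the crossing of `H`
from the side of the fundamental chamber. -/
def Disagree (o o' : Orientation P) (H : P.Wall) : Prop := o.wallSign 1 H ≠ o'.wallSign 1 H

/-- The orientations `o`, `o'` are adjacent: `o • s_H = o'` for all walls `H` at which they
disagree, where `(o • g)(g', s) = o(g g', s)`. The element `s_H ∈ W` acts through its lifts
to `G`. -/
def Adjacent (o o' : Orientation P) : Prop :=
  ∀ H : P.Wall, o.Disagree o' H → ∀ h : G, P.π h = ((H : P.aff) : W) →
    ∀ g s, o.toFun (h * g) s = o'.toFun g s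

open Classical in
/-- The finite set of walls which separate `1` and `g` and at which `o`, `o'` disagree. -/
noncomputable def diffWalls (o o' : Orientation P) (g : G) : Finset P.Wall :=
  {H ∈ P.sepWalls g | o.Disagree o' H}

end Orientation

namespace HeckeParam

variable {G W : Type*} [Group G] [Group W] {P : ProPCoxeterGroup G W}
  {R : Type*} [CommRing R] (D : HeckeParam P R)

/-- The product `T₁ ⋯ T_r` belonging to a list `s₁, …, s_r` and a starting point `g`, where `T_i` is
`T_{n_{s_i}}` if `o(g s₁ ⋯ s_{i-1}, s_i) = 1` and `T_{n_{s_i}} - b_{s_i}` otherwise. -/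
noncomputable def thetaWord (o : Orientation P) : G → List P.S → D.Hecke
  | _, [] => 1
  | g, s :: l => (if o.toFun g s = 1 then D.T (P.n s) else D.T (P.n s) - D.ofT (D.b s)) *
      thetaWord o (g * P.n s) l

/-- The integral Bernstein map: `T₁ ⋯ T_r T_u`, computed from a reduced expression
`g = n_{s₁} ⋯ n_{s_r} u`. It does not depend on the choice of this expression. -/
noncomputable def thetaHat (o : Orientation P) (g : G) : D.Hecke :=
  D.thetaWord o 1 (P.exists_reduced g).choose *
    D.T (P.exists_reduced g).choose_spec.choose

/-- A choice of a square root in `Rˣ` of the parameter `a_s` for every conjugacy class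
`[s] ∈ W \ ℌ`, given as a function on `ℌ` which is invariant under conjugation by `W`. -/
structure SqrtChoice (D : HeckeParam P R) where
  root : P.Wall → Rˣ
  root_conj : ∀ (w : W) (H H' : P.Wall),
    ((H' : P.aff) : W) = w * ((H : P.aff) : W) * w⁻¹ → root H' = root H
  root_sq : ∀ s : P.S, (root (P.simpleWall s) : R) ^ 2 = D.a s

namespace SqrtChoice

variable {D} (q : D.SqrtChoice)

/-- The normalized Bernstein map: the integral one, divided by the product of the square roots over
the walls which separate `1` and `g`. -/
noncomputable def thetaTilde (o : Orientation P) (g : G) : D.Hecke :=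
  (((∏ H ∈ P.sepWalls g, q.root H)⁻¹ : Rˣ) : R) • D.thetaHat o g

/-- The element `Ξ_o(H) = √a_s⁻¹ w(b_s) θ_o(w n_s⁻¹ w⁻¹)`, where `w ∈ G` and `s ∈ S` are such that
`π(w n_s w⁻¹) = H`. It does not depend on the choice of `w` and `s`. -/
noncomputable def Xi (o : Orientation P) (H : P.Wall) : D.Hecke :=
  (((q.root (P.simpleWall (P.baseSimple H)))⁻¹ : Rˣ) : R) •
    (D.ofT (P.actT R (P.base H) (D.b (P.baseSimple H))) *
      q.thetaTilde o (P.base H * (P.n (P.baseSimple H))⁻¹ * (P.base H)⁻¹))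

end SqrtChoice

end HeckeParam

end ProP

/-! The normalized Bernstein map is the value at the base point `1` of a cocycle. There are units
θ_o(g, h) of the Hecke algebra, for all g, h in `G`, with θ_o(g, hh') = θ_o(g, h) θ_o(gh, h'). Here
θ_o(g, n_s) is √a_s⁻¹ T_{n_s} or √a_s⁻¹ (T_{n_s} - b_s) according to the sign o(g, s), and θ_o(g, u)
= T_u for u of length zero. On products that are not reduced this is much stronger than the
definition of the Bernstein map, and it makes the theorem a short induction on length.

Write w = g n_s with ℓ(w) = ℓ(g) + 1, and H = π(g) s π(g)⁻¹. Then θ_o(1, w) - θ_o'(1, w) equals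
(θ_o(1, g) - θ_o'(1, g)) θ_o(g, n_s) + θ_o'(1, g) (θ_o(g, n_s) - θ_o'(g, n_s)). The first summand is
handled by induction. The second vanishes if o and o' agree at H. Otherwise it is o(1, H) √a_s⁻¹
g(b_s) θ_o'(1, g). Put x = g n_s⁻¹ g⁻¹, a lift of H with g = x w. The cocycle rule gives θ_o'(1, g)
= θ_o'(1, x) θ_o'(x, w), and adjacency says that o' seen from x is o, so θ_o'(x, w) = θ_o(1, w).
What remains in front is o(1, H) Ξ_o'(H): see `theta_sub_theta` and `theta_sub`.

To construct the cocycle, let τ(g) be T_g divided by the square roots of the walls crossed. It is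
multiplicative when lengths add, and takes values in units by the quadratic relation. For any such τ
with values in a group K, send n_s to the function which is τ(n_s) where the sign is +1 and
τ(n_s⁻¹)⁻¹ where it is -1, paired with n_s, in the semidirect product of functions G → K by G. The
braid relation holds because of the shape of the sign sequences (`LengthMul.braid_of_pos`), so the
presentation of `G` by the n_s and the elements of length zero (`LiftData.sec`) yields a section,
whose first component is the cocycle.

The same construction, with K built from integer functions on the walls, counts signed wall
crossings; it shows that o(1, H) does not depend on choices (`toFun_eq_of_wall_eq`). -/

namespace ProP

/-! ### Separation by walls in a Coxeter group -/

section Coxeter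

variable {B A : Type*} {M : CoxeterMatrix B} [Group A] (cs : CoxeterSystem M A)

theorem separates_one_iff_sign (t : Refl cs) (w : A) :
    Separates cs t 1 w ↔ (canonicalAction cs w⁻¹ (t, 1)).2 = -1 := by
  rw [separates_one_iff, sign_eq_iff]

/-- The signs of the canonical action multiply along (xy)⁻¹ = y⁻¹ x⁻¹, so separation adds modulo 2,
with the wall transported by x⁻¹. -/
theorem separates_one_mul (t : Refl cs) (x y : A) :
    Separates cs t 1 (x * y) ↔ (Separates cs t 1 x ↔ ¬ Separates cs (t.conj x⁻¹) 1 y) := by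
  simp only [separates_one_iff_sign]
  rw [mul_inv_rev, map_mul, Equiv.Perm.mul_apply, canonicalAction_apply cs x⁻¹,
    canonicalAction_apply cs y⁻¹]
  generalize (canonicalAction cs y⁻¹ (t.conj x⁻¹, 1)).2 = b
  generalize (canonicalAction cs x⁻¹ (t, 1)).2 = a
  rcases Int.units_eq_one_or a with rfl | rfl <;> rcases Int.units_eq_one_or b with rfl | rfl <;>
    simp

theorem separates_one_simple (t : Refl cs) (i : B) :
    Separates cs t 1 (cs.simple i) ↔ t.1 = cs.simple i := by
  rw [separates_one_iff, cs.length_simple, Nat.lt_one_iff, cs.length_eq_zero_iff,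
    mul_eq_one_iff_eq_inv, cs.inv_simple]

end Coxeter

/-! ### Alternating products -/

section AltProd

theorem altProd_succ' {G : Type*} [Monoid G] (a b : G) (j : ℕ) :
    altProd a b (j + 1) = altProd a b j * (if Even j then a else b) := by
  induction j generalizing a b with
  | zero => simp [altProd]
  | succ j ih =>
    rw [altProd, ih b a, altProd, mul_assoc]
    congr 2
    simp only [Nat.even_add_one]
    split_ifs <;> rfl

theorem altProd_add {G : Type*} [Monoid G] (a b : G) (i j : ℕ) :
    altProd a b (i + j) = altProd a b i * (if Even i then altProd a b j else altProd b a j) := by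
  induction i generalizing a b with
  | zero => simp [altProd]
  | succ i ih =>
    rw [show i + 1 + j = (i + j) + 1 by ring, altProd, ih b a, altProd, mul_assoc]
    congr 2
    simp only [Nat.even_add_one]
    split_ifs <;> rfl

theorem altProd_two_mul {G : Type*} [Monoid G] (a b : G) (j : ℕ) :
    altProd a b (2 * j) = (a * b) ^ j := by
  induction j with
  | zero => simp [altProd]
  | succ j ih => rw [show 2 * (j + 1) = 2 * j + 1 + 1 by ring, altProd, altProd, ih, pow_succ',
      mul_assoc]

theorem map_altProd {G H F : Type*} [Monoid G] [Monoid H] [FunLike F G H] [MonoidHomClass F G H]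
    (f : F) (a b : G) (j : ℕ) : f (altProd a b j) = altProd (f a) (f b) j := by
  induction j generalizing a b with
  | zero => simp [altProd]
  | succ j ih => rw [altProd, map_mul, ih, altProd]

/-- For involutions the inverse of a word is the reversed word. It ends in b where the second word
starts with a, so the concatenation still alternates. -/
theorem altProd_inv_mul {G : Type*} [Group G] {a b : G} (ha : a⁻¹ = a) (hb : b⁻¹ = b) (i j : ℕ) :
    (altProd b a i)⁻¹ * altProd a b j =
      if Even i then altProd a b (i + j) else altProd b a (i + j) := by
  induction i with
  | zero => simp [altProd]
  | succ i ih =>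
    rw [altProd_succ', mul_inv_rev, mul_assoc, ih, show i + 1 + j = (i + j) + 1 by ring]
    simp only [Nat.even_add_one, altProd]
    split_ifs <;> simp_all

/-- The inverse of an alternating word of m involutions is again one of the two such words. If these
coincide, their common value squares to 1, and (ab)^m is this square. -/
theorem mul_pow_eq_one_of_altProd_eq {G : Type*} [Group G] {a b : G} (ha : a⁻¹ = a) (hb : b⁻¹ = b)
    {m : ℕ} (h : altProd a b m = altProd b a m) : (a * b) ^ m = 1 := by
  have h1 := altProd_inv_mul ha hb m 0
  simp only [altProd, mul_one, add_zero, h, ite_self] at h1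
  rw [← altProd_two_mul, two_mul, altProd_add, h, ite_self]
  nth_rw 1 [← h1]
  exact inv_mul_cancel _

end AltProd

/-! ### Lengths of alternating words -/

section CoxeterAlt

variable {B A : Type*} {M : CoxeterMatrix B} [Group A] (cs : CoxeterSystem M A)

/-- The walls crossed by a word are its letters conjugated by the preceding prefixes; for an
alternating word these are the alternating words of odd length. -/
theorem exists_of_separates_altProd (i j : B) (n : ℕ) (t : Refl cs)
    (h : Separates cs t 1 (altProd (cs.simple i) (cs.simple j) n)) :
    ∃ k < n, t.1 = altProd (cs.simple i) (cs.simple j) (2 * k + 1) := by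
  induction n generalizing i j t with
  | zero => simp [separates_one_iff, altProd] at h
  | succ n ih =>
    rw [altProd, separates_one_mul, separates_one_simple] at h
    by_cases ht : t.1 = cs.simple i
    · exact ⟨0, by omega, by simp [altProd, ht]⟩
    · have h' : Separates cs (t.conj (cs.simple i)⁻¹) 1 (altProd (cs.simple j) (cs.simple i) n) := by
        tauto
      obtain ⟨k, hk, hk'⟩ := ih j i _ h'
      refine ⟨k + 1, by omega, ?_⟩
      rw [show 2 * (k + 1) + 1 = (2 * k + 1 + 1) + 1 by ring, altProd, altProd_succ', ← hk']
      simp [Refl.conj, mul_assoc]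

/-- If a new first letter `i` shortened the word, its wall would be one of those crossed by the
rest, and this forces a power of s_i s_j with small positive exponent to be 1. Only the order of the
product enters, not the entry of the Coxeter matrix. -/
theorem length_altProd (i j : B) (n : ℕ)
    (h : ∀ k, 0 < k → k < n → (cs.simple i * cs.simple j) ^ k ≠ 1) :
    cs.length (altProd (cs.simple i) (cs.simple j) n) = n := by
  induction n generalizing i j with
  | zero => simp [altProd]
  | succ n ih =>
    have h' : ∀ k, 0 < k → k < n → (cs.simple j * cs.simple i) ^ k ≠ 1 := by
      intro k hk hkn h1
      apply h k hk (by omega)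
      have := congrArg (·⁻¹) h1
      simpa [← inv_pow] using this
    have h2 := ih j i h'
    rw [altProd]
    rcases cs.length_simple_mul (altProd (cs.simple j) (cs.simple i) n) i with h3 | h3
    · rw [h3, h2]
    · exfalso
      obtain ⟨k, hk, hk'⟩ := exists_of_separates_altProd cs j i n
        ⟨cs.simple i, cs.isReflection_simple i⟩ ((separates_one_iff cs _ _).2 (by simp; omega))
      refine h (k + 1) (by omega) (by omega) ?_
      rw [← altProd_two_mul, show 2 * (k + 1) = 2 * k + 1 + 1 by ring, altProd, ← hk']
      simp

end CoxeterAlt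

/-! ### Length and walls in the extended Coxeter group and in its extension -/

namespace ExtendedCoxeterGroup

variable {W : Type*} [Group W] (E : ExtendedCoxeterGroup W)

theorem affPart_coe (x : E.aff) : E.affPart (x : W) = x :=
  Subtype.ext (by simp [affPart, E.proj_aff])

theorem aff_normal : E.aff.Normal := E.ker_proj ▸ E.proj.normal_ker

theorem eq_of_coe_mul_eq {x y : E.aff} {u v : E.Ω} (h : (x : W) * u = y * v) : x = y := by
  have h1 := congrArg E.proj h
  rw [map_mul, map_mul, E.proj_aff, E.proj_aff, one_mul, one_mul, E.proj_coe, E.proj_coe] at h1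
  rw [h1] at h
  exact Subtype.ext (mul_right_cancel h)

theorem len_inv (w : W) : E.len w⁻¹ = E.len w := by
  have h1 : w = (E.affPart w : W) * E.proj w := (E.affPart_mul_proj w).symm
  have h2 : E.len w = E.cs.length (E.affPart w) := rfl
  rw [h2]
  conv_lhs => rw [h1, mul_inv_rev, E.len_unit_mul _ (inv_mem (E.proj w).2)]
  rw [← Subgroup.coe_inv, len, affPart_coe, E.cs.length_inv]

theorem len_simple (s : E.S) : E.len (s : W) = 1 := by
  rw [len, ← E.simple_coe, affPart_coe, E.cs.length_simple]

theorem len_altProd {s t : E.S} {n : ℕ} (hn : n ≤ orderOf (s * t : W)) : E.len (altProd (s : W) t n) = n := by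
  rw [← E.simple_coe s, ← E.simple_coe t, ← Subgroup.coe_subtype, ← map_altProd,
    Subgroup.coe_subtype, len, affPart_coe]
  refine length_altProd E.cs s t n fun k hk hkn h1 => ?_
  have := congrArg (Subtype.val) h1
  simp only [Subgroup.coe_pow, Subgroup.coe_mul, E.simple_coe, Subgroup.coe_one] at this
  exact absurd (orderOf_le_of_pow_eq_one hk this) (by omega)

theorem separates_one_iff_len (H : E.Wall) (w : W) :
    E.Separates H 1 w ↔ E.len (((H : E.aff) : W) * w) < E.len w := by
  rw [Separates, affPart_one, separates_one_iff, len, len]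
  have : E.affPart (((H : E.aff) : W) * w) = H * E.affPart w := by
    refine Subtype.ext ?_
    simp [affPart, E.proj_aff, mul_assoc]
  rw [this]

/-- The conjugate `w H w⁻¹` of a wall by an element of the extended Coxeter group. -/
def conjWall (w : W) (H : E.Wall) : E.Wall :=
  ⟨⟨w * ((H : E.aff) : W) * w⁻¹, E.aff_normal.conj_mem _ H.1.2 w⟩, by
    obtain ⟨⟨h, hh⟩, x, s, hx⟩ := H
    have hx' : h = (x : W) * s * (x : W)⁻¹ := by
      have := congrArg Subtype.val hx
      simpa [E.simple_coe] using this
    refine ⟨E.affPart (w * x), E.act (E.proj w) s, Subtype.ext ?_⟩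
    simp [hx', E.simple_coe, affPart, E.proj_aff, act, mul_assoc]⟩

@[simp]
theorem conjWall_coe (w : W) (H : E.Wall) :
    ((E.conjWall w H : E.aff) : W) = w * ((H : E.aff) : W) * w⁻¹ := rfl

theorem wall_ext {H H' : E.Wall} (h : ((H : E.aff) : W) = ((H' : E.aff) : W)) : H = H' :=
  Subtype.ext (Subtype.ext h)

theorem conjWall_mul (w w' : W) (H : E.Wall) :
    E.conjWall (w * w') H = E.conjWall w (E.conjWall w' H) :=
  E.wall_ext (by simp [mul_assoc])

theorem conjWall_one (H : E.Wall) : E.conjWall 1 H = H := E.wall_ext (by simp)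

theorem conjWall_eq_iff (w : W) (H H' : E.Wall) :
    E.conjWall w H = H' ↔ H = E.conjWall w⁻¹ H' := by
  constructor
  · rintro rfl; rw [← conjWall_mul, inv_mul_cancel, conjWall_one]
  · rintro rfl; rw [← conjWall_mul, mul_inv_cancel, conjWall_one]

theorem separates_one_mul (H : E.Wall) (w w' : W) :
    E.Separates H 1 (w * w') ↔
      (E.Separates H 1 w ↔ ¬ E.Separates (E.conjWall w⁻¹ H) 1 w') := by
  have h : E.affPart (w * w') = E.affPart w * E.affPart (E.proj w * w') := by
    refine Subtype.ext ?_
    simp [affPart, E.proj_coe, mul_assoc]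
  -- The Coxeter group rule involves the affine part of `proj w * w'`. Left multiplication by Ω
  -- preserves length, which moves the criterion from conjugation by `affPart w` to conjugation by
  -- `w`.
  have h2 : ProP.Separates E.cs (H.conj (E.affPart w)⁻¹) 1 (E.affPart (E.proj w * w')) ↔
      E.Separates (E.conjWall w⁻¹ H) 1 w' := by
    have h3 := E.separates_one_iff_len (H.conj (E.affPart w)⁻¹) (E.proj w * w')
    rw [Separates, affPart_one] at h3
    rw [h3, separates_one_iff_len, E.len_unit_mul _ (E.proj w).2]
    have : ((H.conj (E.affPart w)⁻¹ : E.aff) : W) * (E.proj w * w') =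
        E.proj w * (((E.conjWall w⁻¹ H : E.aff) : W) * w') := by
      simp [affPart, Refl.conj, mul_assoc]
    rw [this, E.len_unit_mul _ (E.proj w).2]
  rw [Separates, affPart_one, h, ProP.separates_one_mul, h2]
  simp only [Separates, affPart_one]

theorem separates_one_simple (H : E.Wall) (s : E.S) :
    E.Separates H 1 (s : W) ↔ H = E.simpleWall s := by
  rw [Separates, affPart_one, ← E.simple_coe, affPart_coe, ProP.separates_one_simple]
  exact ⟨fun h => Subtype.ext h, fun h => h ▸ rfl⟩

@[simp]
theorem simpleWall_coe (s : E.S) : ((E.simpleWall s : E.aff) : W) = s := E.simple_coe s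

theorem not_separates_of_mem {w : W} (hw : w ∈ E.Ω) (H : E.Wall) : ¬ E.Separates H 1 w := by
  rw [separates_one_iff_len, (E.len_eq_zero_iff w).2 hw]; omega

theorem separates_one_mul_simple (H : E.Wall) (w : W) (s : E.S) :
    E.Separates H 1 (w * s) ↔ (E.Separates H 1 w ↔ ¬ H = E.conjWall w (E.simpleWall s)) := by
  rw [separates_one_mul, separates_one_simple, conjWall_eq_iff, inv_inv]

theorem conjWall_simpleWall_mul (w : W) (s : E.S) :
    ((E.conjWall w (E.simpleWall s) : E.aff) : W) * w = w * s := by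
  simp

theorem separates_conjWall_simpleWall (w : W) (s : E.S) :
    E.Separates (E.conjWall w (E.simpleWall s)) 1 w ↔ E.len (w * s) < E.len w := by
  rw [separates_one_iff_len, conjWall_simpleWall_mul]

theorem inv_coe_simple (s : E.S) : (s : W)⁻¹ = s := inv_eq_of_mul_eq_one_left (E.simple_mul_self s)

end ExtendedCoxeterGroup

namespace ProPCoxeterGroup

variable {G W : Type*} [Group G] [Group W] (P : ProPCoxeterGroup G W)

theorem mem_sepWalls {g : G} {H : P.Wall} : H ∈ P.sepWalls g ↔ P.Separates H 1 (P.π g) := by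
  simp [sepWalls]

theorem length_inv (g : G) : P.length g⁻¹ = P.length g := by
  rw [length, map_inv, P.len_inv, length]

theorem length_n (s : P.S) : P.length (P.n s) = 1 := by
  rw [length, P.π_n, P.len_simple]

theorem length_unit {u : G} (hu : u ∈ P.Ω₁) : P.length u = 0 := (P.length_eq_zero_iff u).2 hu

theorem length_mul_le (g h : G) : P.length (g * h) ≤ P.length g + P.length h := by
  simp only [length, map_mul]
  exact P.len_mul_le _ _

theorem n_mul_n_mem (s : P.S) : P.n s * P.n s ∈ P.T := by
  rw [MonoidHom.mem_ker, map_mul, P.π_n, P.simple_mul_self]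

/-- The conjugate of `s ∈ S` by an element of `Ω₁`. -/
def actS (u : G) (hu : u ∈ P.Ω₁) (s : P.S) : P.S := P.act ⟨P.π u, hu⟩ s

theorem actS_mul (u : G) (hu : u ∈ P.Ω₁) (s : P.S) : (P.actS u hu s : W) * P.π u = P.π u * s := by
  simp [actS, ExtendedCoxeterGroup.act]

theorem length_altProd_n {s t : P.S} {n : ℕ} (hn : n ≤ orderOf (s * t : W)) :
    P.length (altProd (P.n s) (P.n t) n) = n := by
  rw [length, map_altProd, P.π_n, P.π_n, P.len_altProd hn]

end ProPCoxeterGroup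
end ProP

/-! ### The presentation of `G` by the n_s and the elements of length zero -/

namespace ProP
namespace ProPCoxeterGroup

variable {G W : Type*} [Group G] [Group W] (P : ProPCoxeterGroup G W)

theorem exists_word (g : G) : ∃ (l : List P.S) (u : P.Ω₁), g = (l.map P.n).prod * (u : G) := by
  obtain ⟨l, u, hu, h, -⟩ := P.exists_reduced g
  exact ⟨l, ⟨u, hu⟩, h⟩

theorem π_prod (l : List P.S) : P.π (l.map P.n).prod = (P.cs.wordProd l : W) := by
  induction l with
  | nil => simp
  | cons s l ih => simp [ih, P.cs.wordProd_cons, P.π_n, P.simple_coe]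

/-- Lifts of the generators `n_s` and `u ∈ Ω₁` of a pro-`p` Coxeter group along a homomorphism
`p : Γ → G` which satisfy the defining relations. -/
structure LiftData {Γ : Type*} [Group Γ] (p : Γ →* G) where
  N : P.S → Γ
  U : P.Ω₁ →* Γ
  p_N : ∀ s, p (N s) = P.n s
  p_U : ∀ u, p (U u) = u
  sq : ∀ s, N s * N s = U ⟨P.n s * P.n s, P.T_le (P.n_mul_n_mem s)⟩
  braid : ∀ s t : P.S, orderOf (s * t : W) ≠ 0 →
    altProd (N s) (N t) (orderOf (s * t : W)) = altProd (N t) (N s) (orderOf (s * t : W))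
  comm : ∀ (u u' : P.Ω₁) (s s' : P.S), (u : G) * P.n s' = P.n s * u' → U u * N s' = N s * U u'

namespace LiftData

variable {P} {Γ : Type*} [Group Γ] {p : Γ →* G} (L : P.LiftData p)

/-- The image of `T` in `Γ`. -/
def T' : Subgroup Γ := (P.T.subgroupOf P.Ω₁).map L.U

theorem mem_T' {x : Γ} : x ∈ L.T' ↔ ∃ (t : G) (ht : t ∈ P.T), L.U ⟨t, P.T_le ht⟩ = x := by
  constructor
  · rintro ⟨⟨t, h⟩, ht, rfl⟩
    exact ⟨t, ht, rfl⟩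
  · rintro ⟨t, ht, rfl⟩
    exact ⟨⟨t, P.T_le ht⟩, ht, rfl⟩

/-- By the relation `comm`, conjugation by `N s` carries the lift of t to the lift of n_s t n_s⁻¹,
which is again in `T`. -/
theorem N_mem_normalizer (s : P.S) : L.N s ∈ Subgroup.normalizer (L.T' : Set Γ) := by
  rw [Subgroup.mem_normalizer_iff]
  intro x
  have hn : P.T.Normal := P.π.normal_ker
  constructor
  · intro hx
    obtain ⟨t, ht, rfl⟩ := L.mem_T'.1 hx
    have ht' := hn.conj_mem t ht (P.n s)
    refine L.mem_T'.2 ⟨_, ht', ?_⟩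
    rw [eq_mul_inv_iff_mul_eq]
    exact L.comm _ _ _ _ (by simp)
  · intro hx
    obtain ⟨t, ht, h⟩ := L.mem_T'.1 hx
    have ht' := hn.conj_mem t ht (P.n s)⁻¹
    rw [inv_inv] at ht'
    refine L.mem_T'.2 ⟨_, ht', ?_⟩
    rw [eq_mul_inv_iff_mul_eq] at h
    rw [L.comm _ ⟨_, P.T_le ht'⟩ s s (by simp [mul_assoc])] at h
    exact mul_left_cancel h

/-- The normalizer of the image of `T`. -/
abbrev Q : Subgroup Γ := Subgroup.normalizer (L.T' : Set Γ)

/-- The image of `N s` in the quotient of the normalizer of the image of `T`. -/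
def quotN (s : P.S) : L.Q ⧸ L.T'.subgroupOf L.Q := QuotientGroup.mk' _ ⟨L.N s, L.N_mem_normalizer s⟩

theorem quotN_inv (s : P.S) : (L.quotN s)⁻¹ = L.quotN s := by
  rw [inv_eq_iff_mul_eq_one, quotN, ← map_mul, QuotientGroup.mk'_apply, QuotientGroup.eq_one_iff,
    Subgroup.mem_subgroupOf]
  exact L.mem_T'.2 ⟨_, P.n_mul_n_mem s, (L.sq s).symm⟩

/-- Modulo the image of `T` the lifts are involutions, so their braid relations become Coxeter
relations. This yields a homomorphism from the affine Coxeter group to the quotient. -/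
theorem isLiftable : P.M.IsLiftable L.quotN := by
  intro s t
  have h1 : (s * t : W) ^ P.M s t = 1 := by
    have := congrArg Subtype.val (P.cs.simple_mul_simple_pow s t)
    rwa [Subgroup.coe_pow, Subgroup.coe_mul, P.simple_coe, P.simple_coe] at this
  -- The braid relations use the order of st, and the Coxeter matrix entry is a multiple of it. If
  -- the order is 0, so is the entry, and nothing is required.
  obtain ⟨c, hc⟩ := orderOf_dvd_of_pow_eq_one h1
  rw [hc, pow_mul]
  by_cases h0 : orderOf (s * t : W) = 0
  · rw [h0, pow_zero, one_pow]
  · rw [mul_pow_eq_one_of_altProd_eq (L.quotN_inv s) (L.quotN_inv t), one_pow]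
    rw [quotN, quotN, ← map_altProd, ← map_altProd]
    congr 1
    refine Subtype.ext ?_
    have h2 := L.braid s t h0
    rw [← Subgroup.coe_subtype, map_altProd, map_altProd]
    exact h2

theorem quotN_prod (l : List P.S) : ∃ h : (l.map L.N).prod ∈ L.Q,
    P.cs.lift ⟨L.quotN, L.isLiftable⟩ (P.cs.wordProd l) = QuotientGroup.mk' _ ⟨_, h⟩ := by
  induction l with
  | nil => exact ⟨one_mem _, by simp; rfl⟩
  | cons s l ih =>
    obtain ⟨h, h'⟩ := ih
    refine ⟨by simpa using mul_mem (L.N_mem_normalizer s) h, ?_⟩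
    rw [P.cs.wordProd_cons, map_mul, P.cs.lift_apply_simple, h', quotN, ← map_mul]
    congr 1

theorem p_prod (l : List P.S) : p (l.map L.N).prod = (l.map P.n).prod := by
  induction l with
  | nil => simp
  | cons s l ih => simp [ih, L.p_N]

/-- This makes the section well defined. Two words with the same value in `G` have the same affine
part in `W`, so the corresponding products of lifts differ by the lift of some t in `T`; applying
`p` identifies t, and the unit parts compensate for it. -/
theorem p_injOn {l l' : List P.S} {u u' : P.Ω₁}
    (h : (l.map P.n).prod * (u : G) = (l'.map P.n).prod * u') :
    (l.map L.N).prod * L.U u = (l'.map L.N).prod * L.U u' := by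
  have h1 := congrArg P.π h
  rw [map_mul, map_mul, P.π_prod, P.π_prod] at h1
  have h2 := P.eq_of_coe_mul_eq (u := ⟨P.π u, u.2⟩) (v := ⟨P.π u', u'.2⟩) h1
  obtain ⟨hl, hl1⟩ := L.quotN_prod l
  obtain ⟨hl', hl1'⟩ := L.quotN_prod l'
  rw [← h2, hl1] at hl1'
  have h3 := QuotientGroup.eq.1 hl1'
  rw [Subgroup.mem_subgroupOf] at h3
  obtain ⟨t, ht, h4⟩ := L.mem_T'.1 h3
  have h5 : (l'.map L.N).prod = (l.map L.N).prod * L.U ⟨t, P.T_le ht⟩ := by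
    rw [h4]; simp
  have h6 := congrArg p h5
  rw [map_mul, L.p_prod, L.p_prod, L.p_U] at h6
  rw [h5, mul_assoc, ← map_mul]
  congr 2
  refine Subtype.ext ?_
  rw [h6, mul_assoc] at h
  exact mul_left_cancel h

/-- Units move to the right through the letters by `comm`, so the normal forms are closed under
multiplication and the section is multiplicative. -/
theorem U_mul_prod (u : P.Ω₁) (l : List P.S) : ∃ (l' : List P.S) (u' : P.Ω₁),
    L.U u * (l.map L.N).prod = (l'.map L.N).prod * L.U u' := by
  induction l generalizing u with
  | nil => exact ⟨[], u, by simp⟩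
  | cons s l ih =>
    have h1 : (P.n (P.actS u u.2 s))⁻¹ * u * P.n s ∈ P.Ω₁ := by
      rw [Subgroup.mem_comap, map_mul, map_mul, map_inv, P.π_n, P.π_n, mul_assoc, ← P.actS_mul u u.2,
        inv_mul_cancel_left]
      exact u.2
    obtain ⟨l', u', h⟩ := ih ⟨_, h1⟩
    refine ⟨P.actS u u.2 s :: l', u', ?_⟩
    rw [List.map_cons, List.prod_cons, ← mul_assoc,
      L.comm u ⟨_, h1⟩ (P.actS u u.2 s) s (by simp [mul_assoc]), mul_assoc, h]
    simp [mul_assoc]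

/-- The value of the section at `g`. -/
noncomputable def sectionFun (g : G) : Γ :=
  ((P.exists_word g).choose.map L.N).prod * L.U (P.exists_word g).choose_spec.choose

theorem sectionFun_word (l : List P.S) (u : P.Ω₁) :
    L.sectionFun ((l.map P.n).prod * (u : G)) = (l.map L.N).prod * L.U u :=
  L.p_injOn (P.exists_word ((l.map P.n).prod * (u : G))).choose_spec.choose_spec.symm

/-- The pro-`p` Coxeter group `G` is presented by its generators `n_s` and `u ∈ Ω₁`: lifts of them
along `p` which satisfy the relations extend to a section of `p`. -/
noncomputable def sec : G →* Γ :=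
  MonoidHom.mk' L.sectionFun fun g h => by
    obtain ⟨l, u, rfl⟩ := P.exists_word g
    obtain ⟨l', u', rfl⟩ := P.exists_word h
    obtain ⟨l'', u'', h1⟩ := L.U_mul_prod u l'
    have h2 := congrArg p h1
    rw [map_mul, map_mul, L.p_prod, L.p_prod, L.p_U, L.p_U] at h2
    have h3 : (l.map P.n).prod * (u : G) * ((l'.map P.n).prod * u') =
        ((l ++ l'').map P.n).prod * ((u'' * u' : P.Ω₁) : G) := by
      rw [List.map_append, List.prod_append, Subgroup.coe_mul]
      calc _ = (l.map P.n).prod * ((u : G) * (l'.map P.n).prod) * u' := by simp only [mul_assoc]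
        _ = _ := by rw [h2]; simp only [mul_assoc]
    rw [h3, sectionFun_word, sectionFun_word, sectionFun_word]
    rw [List.map_append, List.prod_append, map_mul]
    calc _ = (l.map L.N).prod * ((l''.map L.N).prod * L.U u'') * L.U u' := by simp only [mul_assoc]
      _ = _ := by rw [← h1]; simp only [mul_assoc]

theorem sec_n (s : P.S) : L.sec (P.n s) = L.N s := by
  change L.sectionFun _ = _
  simpa using L.sectionFun_word [s] 1

theorem sec_unit (u : P.Ω₁) : L.sec (u : G) = L.U u := by
  change L.sectionFun _ = _
  simpa using L.sectionFun_word [] u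

theorem p_sec (g : G) : p (L.sec g) = g := by
  obtain ⟨l, u, rfl⟩ := P.exists_word g
  change p (L.sectionFun _) = _
  rw [sectionFun_word, map_mul, L.p_prod, L.p_U]

end LiftData
end ProPCoxeterGroup
end ProP

/-! ### Orientations read on `G` -/

namespace ProP

namespace Orientation

variable {G W : Type*} [Group G] [Group W] {P : ProPCoxeterGroup G W} (o : Orientation P)

theorem toFun_congr {g g' : G} (h : P.π g = P.π g') (s : P.S) : o.toFun g s = o.toFun g' s := by
  obtain ⟨o₁, -, h1⟩ := o.isOrientation
  rw [h1, h1, h]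

theorem toFun_mul_n (g : G) (s : P.S) : o.toFun (g * P.n s) s = -o.toFun g s := by
  obtain ⟨o₁, ⟨o₀, h0, h2⟩, h1⟩ := o.isOrientation
  rw [h1, h1, h2, h2, map_mul, P.π_n, P.affPart_mul_simple, map_mul, P.proj_simple, mul_one, h0.1]

theorem toFun_mul_unit (g : G) {u : G} (hu : u ∈ P.Ω₁) {s s' : P.S}
    (h : (s : W) * P.π u = P.π u * s') : o.toFun (g * u) s' = o.toFun g s := by
  obtain ⟨o₁, ⟨o₀, h0, h2⟩, h1⟩ := o.isOrientation
  have hp : P.proj (P.π u) = ⟨P.π u, hu⟩ := P.proj_coe ⟨P.π u, hu⟩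
  rw [h1, h1, h2, h2, map_mul]
  congr 1
  · exact P.affPart_mul_unit (P.π g) ⟨P.π u, hu⟩
  · refine Subtype.ext ?_
    have h3 : P.π u * s' * (P.π u)⁻¹ = s := by rw [← h, mul_inv_cancel_right]
    simp only [ExtendedCoxeterGroup.act, map_mul, hp, Subgroup.coe_mul, mul_inv_rev, ← h3, mul_assoc]

/-- The Ω-component v of g does not change along a word in the n_s. Hence the signs are those of the
Coxeter orientation for the conjugates of s and t by v, whose product has the same order as st. -/
theorem toFun_braid (g : G) {s t : P.S} (h : orderOf (s * t : W) ≠ 0) :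
    ∃ k ≤ orderOf (s * t : W), ∃ ε : ℤˣ,
      (∀ j < orderOf (s * t : W),
        o.toFun (g * altProd (P.n s) (P.n t) j) (if Even j then s else t) =
          if j < k then ε else -ε) ∧
      (∀ j < orderOf (s * t : W),
        o.toFun (g * altProd (P.n t) (P.n s) j) (if Even j then t else s) =
          if j < orderOf (s * t : W) - k then -ε else ε) := by
  obtain ⟨o₁, ⟨o₀, h0, h2⟩, h1⟩ := o.isOrientation
  set v := P.proj (P.π g) with hv
  have aff : ∀ (s t : P.S) (j : ℕ), P.affPart (P.π (g * altProd (P.n s) (P.n t) j)) =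
      P.affPart (P.π g) * altProd (P.cs.simple (P.act v s)) (P.cs.simple (P.act v t)) j ∧
      P.proj (P.π (g * altProd (P.n s) (P.n t) j)) = v := by
    intro s t j
    induction j with
    | zero => simp [altProd, hv]
    | succ j ih =>
      rw [altProd_succ', ← mul_assoc, map_mul P.π (g * _), altProd_succ']
      split_ifs
      · rw [P.π_n, P.affPart_mul_simple, map_mul P.proj, P.proj_simple, mul_one, ih.1, ih.2, mul_assoc]
        exact ⟨rfl, rfl⟩
      · rw [P.π_n, P.affPart_mul_simple, map_mul P.proj, P.proj_simple, mul_one, ih.1, ih.2, mul_assoc]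
        exact ⟨rfl, rfl⟩
  have ho : orderOf (P.act v s * P.act v t : W) = orderOf (s * t : W) := by
    have : (P.act v s * P.act v t : W) = MulAut.conj (v : W) (s * t) := by
      simp [ExtendedCoxeterGroup.act, mul_assoc]
    rw [this]
    exact (MulAut.conj (v : W)).orderOf_eq (s * t : W)
  obtain ⟨k, hk, ε, hA, hB⟩ := h0.2 (P.act v s) (P.act v t) (by rwa [ho]) (P.affPart (P.π g))
  rw [ho] at hk hA hB
  refine ⟨k, hk, ε, fun j hj => ?_, fun j hj => ?_⟩
  · rw [h1, h2, (aff s t j).1, (aff s t j).2, ← hA j hj]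
    split_ifs <;> rfl
  · rw [h1, h2, (aff t s j).1, (aff t s j).2, ← hB j hj]
    split_ifs <;> rfl

end Orientation

/-! ### Cocycles attached to length-multiplicative maps and orientations -/

section Cocycle

variable {G K : Type*} [Group G] [Group K]

/-- The action of `G` on functions on `G` by right translation. -/
def shift (G K : Type*) [Group G] [Group K] : G →* MulAut (G → K) where
  toFun h :=
    { toFun := fun f g => f (g * h)
      invFun := fun f g => f (g * h⁻¹)
      left_inv := fun f => by ext g; simp
      right_inv := fun f => by ext g; simp
      map_mul' := fun _ _ => rfl }
  map_one' := by ext; simp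
  map_mul' _ _ := by ext; simp [mul_assoc]

@[simp]
theorem shift_apply (h : G) (f : G → K) (g : G) : shift G K h f g = f (g * h) := rfl

end Cocycle

namespace ProPCoxeterGroup

variable {G W : Type*} [Group G] [Group W] (P : ProPCoxeterGroup G W)
  {K : Type*} [Group K]

/-- A map on `G` which is multiplicative on products whose lengths add up. -/
def LengthMul (τ : G → K) : Prop :=
  ∀ g h, P.length (g * h) = P.length g + P.length h → τ (g * h) = τ g * τ h

variable {P} {τ : G → K}

namespace LengthMul

variable (hτ : P.LengthMul τ) (o : Orientation P)
include hτ

theorem mul_unit (g : G) {u : G} (hu : u ∈ P.Ω₁) : τ (g * u) = τ g * τ u :=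
  hτ g u (by rw [P.length_mul_unit g hu, P.length_unit hu, add_zero])

theorem unit_mul (g : G) {u : G} (hu : u ∈ P.Ω₁) : τ (u * g) = τ u * τ g :=
  hτ u g (by rw [P.length_unit_mul g hu, P.length_unit hu, zero_add])

theorem map_one : τ 1 = 1 := by
  have := hτ.mul_unit 1 (one_mem P.Ω₁)
  simpa using this

omit hτ in
/-- The value of the cocycle attached to `τ` and `o` at `n_s`. -/
noncomputable def step (τ : G → K) (o : Orientation P) (g : G) (s : P.S) : K :=
  if o.toFun g s = 1 then τ (P.n s) else (τ (P.n s)⁻¹)⁻¹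

omit hτ in
/-- The lift of `n_s` to the semidirect product. -/
noncomputable def stepN (τ : G → K) (o : Orientation P) (s : P.S) : (G → K) ⋊[shift G K] G :=
  ⟨fun g => step τ o g s, P.n s⟩

omit hτ in
theorem stepN_altProd_right (s t : P.S) (j : ℕ) :
    (altProd (stepN τ o s) (stepN τ o t) j).right = altProd (P.n s) (P.n t) j :=
  map_altProd (SemidirectProduct.rightHom : (G → K) ⋊[shift G K] G →* G) _ _ j

omit hτ in
theorem stepN_altProd_left (s t : P.S) (j : ℕ) (g : G) :
    (altProd (stepN τ o s) (stepN τ o t) (j + 1)).left g =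
      step τ o g s * (altProd (stepN τ o t) (stepN τ o s) j).left (g * P.n s) := by
  simp [altProd, stepN]

/-- Along a stretch of positive signs the factors τ(n_s) combine, since lengths add up in a reduced
word. -/
theorem altProd_left_pos (s t : P.S) (j : ℕ) (g : G)
    (hlen : ∀ i ≤ j, P.length (altProd (P.n s) (P.n t) i) = i ∧
      P.length (altProd (P.n t) (P.n s) i) = i)
    (ho : ∀ i < j, o.toFun (g * altProd (P.n s) (P.n t) i) (if Even i then s else t) = 1) :
    (altProd (stepN τ o s) (stepN τ o t) j).left g = τ (altProd (P.n s) (P.n t) j) := by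
  induction j generalizing s t g with
  | zero => simp [altProd, hτ.map_one]
  | succ j ih =>
    rw [stepN_altProd_left, ih t s, altProd, hτ]
    · have := ho 0 (by omega)
      rw [step, if_pos (by simpa [altProd] using this)]
    · have := (hlen (j + 1) le_rfl).1
      rw [altProd] at this
      rw [this, P.length_n, (hlen j (by omega)).2, add_comm]
    · exact fun i hi => (hlen i (by omega)).symm
    · intro i hi
      have := ho (i + 1) (by omega)
      rw [altProd, ← mul_assoc] at this
      rw [← this]
      simp only [Nat.even_add_one]
      split_ifs <;> rfl

/-- On negative stretches the factors are τ(n_s⁻¹)⁻¹, and they combine in the same way after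
inverting the word. -/
theorem altProd_left_neg (s t : P.S) (j : ℕ) (g : G)
    (hlen : ∀ i ≤ j, P.length (altProd (P.n s) (P.n t) i) = i ∧
      P.length (altProd (P.n t) (P.n s) i) = i)
    (ho : ∀ i < j, o.toFun (g * altProd (P.n s) (P.n t) i) (if Even i then s else t) = -1) :
    (altProd (stepN τ o s) (stepN τ o t) j).left g = (τ (altProd (P.n s) (P.n t) j)⁻¹)⁻¹ := by
  induction j generalizing s t g with
  | zero => simp [altProd, hτ.map_one]
  | succ j ih =>
    rw [stepN_altProd_left, ih t s, altProd, mul_inv_rev, hτ, mul_inv_rev]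
    · have := ho 0 (by omega)
      rw [step, if_neg (by simp [altProd] at this; simp [this])]
    · have := (hlen (j + 1) le_rfl).1
      rw [altProd] at this
      rw [← mul_inv_rev, P.length_inv, P.length_inv, P.length_inv, this, P.length_n,
        (hlen j (by omega)).2]
    · exact fun i hi => (hlen i (by omega)).symm
    · intro i hi
      have := ho (i + 1) (by omega)
      rw [altProd, ← mul_assoc] at this
      rw [← this]
      simp only [Nat.even_add_one]
      split_ifs <;> rfl

omit hτ in
theorem altProd_left_add (s t : P.S) (i j : ℕ) (g : G) :
    (altProd (stepN τ o s) (stepN τ o t) (i + j)).left g =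
      (altProd (stepN τ o s) (stepN τ o t) i).left g *
        (altProd (stepN τ o (if Even i then s else t)) (stepN τ o (if Even i then t else s))
          j).left (g * altProd (P.n s) (P.n t) i) := by
  rw [altProd_add, SemidirectProduct.mul_left, Pi.mul_apply, shift_apply, stepN_altProd_right]
  split_ifs <;> rfl

omit hτ in
theorem altProd_n_add (s t : P.S) (i j : ℕ) :
    altProd (P.n s) (P.n t) (i + j) = altProd (P.n s) (P.n t) i *
      altProd (P.n (if Even i then s else t)) (P.n (if Even i then t else s)) j := by
  rw [altProd_add]
  split_ifs <;> rfl

omit hτ in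
theorem sign_shift {s t : P.S} {g : G} {i j : ℕ} {ε : ℤˣ}
    (h : o.toFun (g * altProd (P.n s) (P.n t) (i + j)) (if Even (i + j) then s else t) = ε) :
    o.toFun (g * altProd (P.n s) (P.n t) i *
        altProd (P.n (if Even i then s else t)) (P.n (if Even i then t else s)) j)
      (if Even j then (if Even i then s else t) else (if Even i then t else s)) = ε := by
  rw [mul_assoc, ← altProd_n_add, ← h]
  congr 1
  have := Nat.even_add (m := i) (n := j)
  split_ifs <;> first | rfl | (exfalso; tauto)

/-- Cut the two words of the braid relation where the signs change: AB = CD with A, D of length k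
and B, C of length l. The two values are τ(A) τ(B⁻¹)⁻¹ and τ(C⁻¹)⁻¹ τ(D). They agree because C⁻¹A =
DB⁻¹ has length k + l, so that τ(C⁻¹) τ(A) and τ(D) τ(B⁻¹) are both its image under τ. -/
theorem braid_of_pos {s t : P.S} {k l : ℕ} {g : G}
    (hbr : altProd (P.n s) (P.n t) (k + l) = altProd (P.n t) (P.n s) (l + k))
    (hlen : ∀ i ≤ k + l, P.length (altProd (P.n s) (P.n t) i) = i ∧
      P.length (altProd (P.n t) (P.n s) i) = i)
    (hs : ∀ j < k + l, o.toFun (g * altProd (P.n s) (P.n t) j) (if Even j then s else t) =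
      if j < k then 1 else -1)
    (ht : ∀ j < k + l, o.toFun (g * altProd (P.n t) (P.n s) j) (if Even j then t else s) =
      if j < l then -1 else 1) :
    (altProd (stepN τ o s) (stepN τ o t) (k + l)).left g =
      (altProd (stepN τ o t) (stepN τ o s) (l + k)).left g := by
  have hlen2 : ∀ r : ℕ, ∀ i ≤ k + l,
      P.length (altProd (P.n (if Even r then s else t)) (P.n (if Even r then t else s)) i) = i ∧
      P.length (altProd (P.n (if Even r then t else s)) (P.n (if Even r then s else t)) i) = i := by
    intro r i hi
    split_ifs
    · exact hlen i hi
    · exact (hlen i hi).symm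
  have hlen3 : ∀ r : ℕ, ∀ i ≤ k + l,
      P.length (altProd (P.n (if Even r then t else s)) (P.n (if Even r then s else t)) i) = i ∧
      P.length (altProd (P.n (if Even r then s else t)) (P.n (if Even r then t else s)) i) = i :=
    fun r i hi => (hlen2 r i hi).symm
  rw [altProd_left_add, altProd_left_add,
    hτ.altProd_left_pos o s t k g (fun i hi => hlen i (by omega))
      (fun i hi => by rw [hs i (by omega), if_pos hi]),
    hτ.altProd_left_neg o t s l g (fun i hi => (hlen i (by omega)).symm)
      (fun i hi => by rw [ht i (by omega), if_pos hi]),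
    hτ.altProd_left_neg o _ _ l _ (fun i hi => hlen2 k i (by omega))
      (fun i hi => sign_shift o (by rw [hs _ (by omega), if_neg (by omega)])),
    hτ.altProd_left_pos o _ _ k _ (fun i hi => hlen3 l i (by omega))
      (fun i hi => sign_shift o (by rw [ht _ (by omega), if_neg (by omega)]))]
  have hA := altProd_n_add s t k l
  have hB := altProd_n_add t s l k
  have hlB := (hlen2 k l (by omega)).1
  have hlD := (hlen3 l k (by omega)).1
  have hlA := (hlen k (by omega)).1
  have hlC := (hlen l (by omega)).2
  -- The n_s need not be involutions, so the inverse is recognized as an alternating word only after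
  -- applying π; length depends on nothing else.
  have hX : P.length ((altProd (P.n t) (P.n s) l)⁻¹ * altProd (P.n s) (P.n t) k) = l + k := by
    rw [length, map_mul, map_inv, map_altProd, map_altProd, P.π_n, P.π_n,
      altProd_inv_mul (P.inv_coe_simple s) (P.inv_coe_simple t)]
    have := hlen (l + k) (by omega)
    rw [length, length, map_altProd, map_altProd, P.π_n, P.π_n] at this
    split_ifs
    · exact this.1
    · exact this.2
  generalize altProd (P.n (if Even k then s else t)) (P.n (if Even k then t else s)) l = B at *
  generalize altProd (P.n (if Even l then t else s)) (P.n (if Even l then s else t)) k = D at *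
  generalize altProd (P.n s) (P.n t) k = A at *
  generalize altProd (P.n t) (P.n s) l = C at *
  rw [hA, hB] at hbr
  have hY : C⁻¹ * A = D * B⁻¹ := by
    rw [inv_mul_eq_iff_eq_mul, ← mul_assoc, ← hbr, mul_inv_cancel_right]
  rw [mul_inv_eq_iff_eq_mul, mul_assoc, eq_inv_mul_iff_mul_eq, ← hτ C⁻¹ A, ← hτ D B⁻¹, hY]
  · rw [← hY, hX, P.length_inv, hlB, hlD, add_comm]
  · rw [hX, P.length_inv, hlC, hlA]

/-- The signs at g and g n_s are opposite, so one factor is τ(n_s) and the other τ(n_s⁻¹)⁻¹. Since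
n_s² has length zero, their product is τ(n_s²) in either order. -/
theorem step_mul_step (g : G) (s : P.S) :
    step τ o g s * step τ o (g * P.n s) s = τ (P.n s * P.n s) := by
  have hu := P.T_le (P.n_mul_n_mem s)
  have h1 : τ (P.n s) = τ (P.n s * P.n s) * τ (P.n s)⁻¹ := by
    rw [← hτ.unit_mul _ hu]; simp
  have h2 : τ (P.n s) = τ (P.n s)⁻¹ * τ (P.n s * P.n s) := by
    rw [← hτ.mul_unit _ hu]; simp
  rw [step, step, o.toFun_mul_n]
  rcases Int.units_eq_one_or (o.toFun g s) with h | h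
  · rw [h, if_pos rfl, if_neg (by decide), mul_inv_eq_iff_eq_mul, ← h1]
  · rw [h, if_neg (by decide), if_pos (by decide), inv_mul_eq_iff_eq_mul, ← h2]

theorem unit_mul_step (g : G) {u u' : G} (hu : u ∈ P.Ω₁) (hu' : u' ∈ P.Ω₁) {s s' : P.S}
    (h : u * P.n s' = P.n s * u') :
    τ u * step τ o (g * u) s' = step τ o g s * τ u' := by
  have h1 : (s : W) * P.π u = P.π u * s' := by
    have h2 := congrArg P.π h
    rw [map_mul, map_mul, P.π_n, P.π_n] at h2
    have h3 : P.π u = (s : W) * P.π u' * s' := by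
      rw [← h2, mul_assoc, P.simple_mul_self, mul_one]
    have h4 := congrArg P.proj h2
    rw [map_mul, map_mul, P.proj_simple, P.proj_simple, mul_one, one_mul] at h4
    -- Comparing Ω-components shows that u and u' have the same image in `W`, so s and s' are
    -- conjugate under π(u) and the two signs coincide.
    have h5 : P.π u = P.π u' := by
      have := congrArg Subtype.val h4
      rwa [P.proj_coe ⟨P.π u, hu⟩, P.proj_coe ⟨P.π u', hu'⟩] at this
    rw [h2, h5]
  rw [step, step, o.toFun_mul_unit g hu h1]
  split_ifs
  · rw [← hτ.unit_mul _ hu, h, hτ.mul_unit _ hu']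
  · rw [mul_inv_eq_iff_eq_mul, mul_assoc, eq_inv_mul_iff_mul_eq, ← hτ.mul_unit _ hu,
      ← hτ.unit_mul _ hu']
    congr 1
    rw [inv_mul_eq_iff_eq_mul, ← mul_assoc, ← h, mul_inv_cancel_right]

/-- The lifts of the generators to the semidirect product satisfy the defining relations of `G`. -/
noncomputable def liftData :
    P.LiftData (SemidirectProduct.rightHom : (G → K) ⋊[shift G K] G →* G) where
  N := stepN τ o
  U := MonoidHom.mk' (fun u => ⟨fun _ => τ u, u⟩) fun u v => by
    refine SemidirectProduct.ext (funext fun g => ?_) rfl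
    exact hτ.mul_unit _ v.2
  p_N _ := rfl
  p_U _ := rfl
  sq s := SemidirectProduct.ext (funext fun g => hτ.step_mul_step o g s) rfl
  braid s t h := by
    refine SemidirectProduct.ext (funext fun g => ?_) ?_
    · obtain ⟨k, hk, ε, hs, ht⟩ := o.toFun_braid g h
      obtain ⟨l, hl⟩ := Nat.exists_eq_add_of_le hk
      have hbr := P.braid s t h
      have hlen : ∀ i ≤ k + l, P.length (altProd (P.n s) (P.n t) i) = i ∧
          P.length (altProd (P.n t) (P.n s) i) = i := by
        intro i hi
        have ho : orderOf (t * s : W) = orderOf (s * t : W) := by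
          rw [← orderOf_inv, mul_inv_rev, P.inv_coe_simple, P.inv_coe_simple]
        exact ⟨P.length_altProd_n (by omega), P.length_altProd_n (by omega)⟩
      rw [hl] at hs ht hbr ⊢
      rw [Nat.add_sub_cancel_left] at ht
      rcases Int.units_eq_one_or ε with rfl | rfl
      · have hc := add_comm k l
        exact (hτ.braid_of_pos o (hc ▸ hbr) hlen hs ht).trans (by rw [hc])
      · have hc := add_comm k l
        rw [hc] at hs ht hbr hlen ⊢
        -- For ε = -1 it is the word starting with t that begins with positive signs: exchange s
        -- with t and k with l.
        have := hτ.braid_of_pos o (k := l) (l := k) (s := t) (t := s) (g := g)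
          (by rw [hc]; exact hbr.symm) (fun i hi => (hlen i hi).symm) (by simpa using ht)
          (by simpa using hs)
        rw [hc] at this
        exact this.symm
    · rw [stepN_altProd_right, stepN_altProd_right, P.braid s t h]
  comm u u' s s' h := SemidirectProduct.ext
    (funext fun g => hτ.unit_mul_step o g u.2 u'.2 h) h

/-- The cocycle attached to `τ` and `o`. -/
noncomputable def cocycle (g h : G) : K := ((hτ.liftData o).sec h).left g

/-- This is the multiplication of the semidirect product: `shift` evaluates the second function at g
h. -/
theorem cocycle_mul (g h h' : G) :
    hτ.cocycle o g (h * h') = hτ.cocycle o g h * hτ.cocycle o (g * h) h' := by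
  have : ((hτ.liftData o).sec h).right = h := (hτ.liftData o).p_sec h
  simp [cocycle, this]

theorem cocycle_n (g : G) (s : P.S) : hτ.cocycle o g (P.n s) = step τ o g s := by
  rw [cocycle, LiftData.sec_n]; rfl

theorem cocycle_unit (g : G) {u : G} (hu : u ∈ P.Ω₁) : hτ.cocycle o g u = τ u := by
  have := (hτ.liftData o).sec_unit ⟨u, hu⟩
  rw [cocycle, this]; rfl

/-- The value on a word, reduced or not, is built from the signs met along it, so it depends only on
the orientation as seen from the starting point. -/
theorem cocycle_congr {o o' : Orientation P} {g g' : G}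
    (h : ∀ x s, o.toFun (g * x) s = o'.toFun (g' * x) s) (x : G) :
    hτ.cocycle o g x = hτ.cocycle o' g' x := by
  have key : ∀ (l : List P.S) (y : G), hτ.cocycle o (g * y) (l.map P.n).prod =
      hτ.cocycle o' (g' * y) (l.map P.n).prod := by
    intro l
    induction l with
    | nil => intro y; simp [hτ.cocycle_unit _ _ (one_mem P.Ω₁)]
    | cons s l ih =>
      intro y
      rw [List.map_cons, List.prod_cons, cocycle_mul, cocycle_mul, mul_assoc, mul_assoc, ih,
        cocycle_n, cocycle_n, step, step, h]
  obtain ⟨l, u, rfl⟩ := P.exists_word x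
  have := key l 1
  rw [mul_one, mul_one] at this
  rw [cocycle_mul, cocycle_mul, this, hτ.cocycle_unit _ _ u.2, hτ.cocycle_unit _ _ u.2]

end LengthMul
end ProPCoxeterGroup
end ProP

/-! ### Signed wall crossings and the independence of o(1, H) from choices -/

namespace ProP

namespace ExtendedCoxeterGroup

variable {W : Type*} [Group W] (E : ExtendedCoxeterGroup W)

/-- If both separated, ww' would be the product of Hw and (w⁻¹Hw)w', which are shorter than w and
w'. -/
theorem not_separates_of_len_mul {w w' : W} (h : E.len (w * w') = E.len w + E.len w')
    {H : E.Wall} (hw : E.Separates H 1 w) : ¬ E.Separates (E.conjWall w⁻¹ H) 1 w' := by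
  intro hw'
  rw [separates_one_iff_len] at hw hw'
  have h1 := E.len_mul_le (((H : E.aff) : W) * w) (((E.conjWall w⁻¹ H : E.aff) : W) * w')
  have h2 : ((H : E.aff) : W) * ((H : E.aff) : W) = 1 := by
    have := congrArg Subtype.val H.2.mul_self
    simpa using this
  have h3 : ((H : E.aff) : W) * w * (((E.conjWall w⁻¹ H : E.aff) : W) * w') = w * w' := by
    simp only [conjWall_coe, inv_inv, mul_assoc, mul_inv_cancel_left]
    rw [← mul_assoc, h2, one_mul]
  rw [h3] at h1
  omega

/-- The action of `W` on functions on the set of walls. -/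
def wallAction (A : Type*) [Group A] : W →* MulAut (E.Wall → A) where
  toFun w :=
    { toFun := fun f H => f (E.conjWall w⁻¹ H)
      invFun := fun f H => f (E.conjWall w H)
      left_inv := fun f => by
        ext H; simp only [← conjWall_mul, inv_mul_cancel, conjWall_one]
      right_inv := fun f => by
        ext H; simp only [← conjWall_mul, mul_inv_cancel, conjWall_one]
      map_mul' := fun _ _ => rfl }
  map_one' := by ext f H; simp [conjWall_one]
  map_mul' w w' := by ext f H; simp [conjWall_mul]

@[simp]
theorem wallAction_apply {A : Type*} [Group A] (w : W) (f : E.Wall → A) (H : E.Wall) :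
    E.wallAction A w f H = f (E.conjWall w⁻¹ H) := rfl

end ExtendedCoxeterGroup

namespace ProPCoxeterGroup

variable {G W : Type*} [Group G] [Group W] (P : ProPCoxeterGroup G W)

open Classical in
/-- The walls separating `1` and `g`, as an element of the semidirect product of the group of
integer valued functions on walls by `W`. -/
noncomputable def wallTau (g : G) :
    (P.Wall → Multiplicative ℤ) ⋊[P.wallAction (Multiplicative ℤ)] W :=
  ⟨fun H => if P.Separates H 1 (P.π g) then Multiplicative.ofAdd 1 else 1, P.π g⟩

/-- When lengths add, no wall is crossed by both factors, so the indicator functions add as integers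
and not only modulo 2. -/
theorem wallTau_lengthMul : P.LengthMul P.wallTau := by
  classical
  intro g h hl
  rw [length, map_mul] at hl
  refine SemidirectProduct.ext (funext fun H => ?_) (map_mul _ _ _)
  have h1 := P.separates_one_mul H (P.π g) (P.π h)
  have h2 := P.not_separates_of_len_mul hl (H := H)
  change (if P.Separates H 1 (P.π (g * h)) then Multiplicative.ofAdd (1 : ℤ) else 1) =
    (if P.Separates H 1 (P.π g) then Multiplicative.ofAdd (1 : ℤ) else 1) *
      (if P.Separates (P.conjWall (P.π g)⁻¹ H) 1 (P.π h) then Multiplicative.ofAdd (1 : ℤ) else 1)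
  rw [map_mul]
  by_cases h3 : P.Separates H 1 (P.π g)
  · rw [if_pos (h1.2 (by tauto)), if_pos h3, if_neg (h2 h3), mul_one]
  · by_cases h4 : P.Separates (P.conjWall (P.π g)⁻¹ H) 1 (P.π h)
    · rw [if_pos (h1.2 (by tauto)), if_neg h3, if_pos h4, one_mul]
    · rw [if_neg (fun h5 => by tauto), if_neg h3, if_neg h4, one_mul]

end ProPCoxeterGroup

namespace Orientation

variable {G W : Type*} [Group G] [Group W] {P : ProPCoxeterGroup G W} (o : Orientation P)

open ProPCoxeterGroup.LengthMul

/-- The signs with which `h`, as a path starting at `g`, crosses the walls. -/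
noncomputable def crossing (g h : G) :
    (P.Wall → Multiplicative ℤ) ⋊[P.wallAction (Multiplicative ℤ)] W :=
  P.wallTau_lengthMul.cocycle o g h

open Classical in
-- A negative sign produces the inverse of the crossing; the wall s is fixed by s, so only its
-- exponent changes sign.
theorem step_wallTau_left (g : G) (s : P.S) (H : P.Wall) :
    (step P.wallTau o g s).left H =
      if H = P.simpleWall s then Multiplicative.ofAdd ((o.toFun g s : ℤˣ) : ℤ) else 1 := by
  have hc : P.conjWall (s : W) H = P.simpleWall s ↔ H = P.simpleWall s := by
    rw [P.conjWall_eq_iff]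
    have : P.conjWall (s : W)⁻¹ (P.simpleWall s) = P.simpleWall s := P.wall_ext (by simp)
    rw [this]
  rcases Int.units_eq_one_or (o.toFun g s) with h | h
  · simp [step, h, ProPCoxeterGroup.wallTau, P.π_n, P.separates_one_simple]
  · simp only [step, h, ProPCoxeterGroup.wallTau, P.π_n, P.separates_one_simple, map_inv,
      P.inv_coe_simple, SemidirectProduct.inv_left, ExtendedCoxeterGroup.wallAction_apply,
      Pi.inv_apply, if_neg (show ¬ (-1 : ℤˣ) = 1 by decide)]
    by_cases hH : H = P.simpleWall s
    · rw [if_pos (by simpa using hc.2 hH), if_pos hH]; rfl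
    · rw [if_neg (by simpa using fun h => hH (hc.1 h)), if_neg hH, inv_one]

theorem step_wallTau_right (g : G) (s : P.S) : (step P.wallTau o g s).right = s := by
  rw [step]
  split_ifs
  · exact P.π_n s
  · simp [ProPCoxeterGroup.wallTau, P.π_n]

theorem crossing_mul (g h h' : G) :
    o.crossing g (h * h') = o.crossing g h * o.crossing (g * h) h' :=
  P.wallTau_lengthMul.cocycle_mul o g h h'

theorem crossing_n (g : G) (s : P.S) : o.crossing g (P.n s) = step P.wallTau o g s :=
  P.wallTau_lengthMul.cocycle_n o g s

theorem crossing_unit (g : G) {u : G} (hu : u ∈ P.Ω₁) : o.crossing g u = P.wallTau u :=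
  P.wallTau_lengthMul.cocycle_unit o g hu

theorem crossing_right (g h : G) : (o.crossing g h).right = P.π h := by
  induction hk : P.length h generalizing h with
  | zero => rw [o.crossing_unit g ((P.length_eq_zero_iff h).1 hk)]; rfl
  | succ k ih =>
    obtain ⟨h', s, rfl, hl⟩ := P.exists_right_factor (g := h) (by omega)
    rw [crossing_mul, SemidirectProduct.mul_right, ih h' (by omega), crossing_n,
      step_wallTau_right, map_mul, P.π_n]

/-- The crossing can be computed along a reduced expression of h, which meets only the walls
separating 1 and h. -/
theorem crossing_left_of_not_separates (g h : G) {H : P.Wall} (hH : ¬ P.Separates H 1 (P.π h)) :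
    (o.crossing g h).left H = 1 := by
  induction hk : P.length h generalizing h with
  | zero =>
    rw [o.crossing_unit g ((P.length_eq_zero_iff h).1 hk)]
    simp [ProPCoxeterGroup.wallTau, hH]
  | succ k ih =>
    obtain ⟨h', s, rfl, hl⟩ := P.exists_right_factor (g := h) (by omega)
    rw [map_mul, P.π_n, P.separates_one_mul_simple] at hH
    have h1 : ¬ (P.Separates H 1 (P.π h') ∧ H = P.conjWall (P.π h') (P.simpleWall s)) := by
      rintro ⟨h1, rfl⟩
      rw [P.separates_conjWall_simpleWall] at h1
      simp only [ProPCoxeterGroup.length, map_mul, P.π_n] at hl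
      omega
    have h2 : ¬ P.Separates H 1 (P.π h') := by tauto
    have h3 : ¬ H = P.conjWall (P.π h') (P.simpleWall s) := by tauto
    rw [crossing_mul, SemidirectProduct.mul_left, Pi.mul_apply, ih h' h2 (by omega), crossing_n,
      crossing_right, ExtendedCoxeterGroup.wallAction_apply, step_wallTau_left, if_neg, one_mul]
    rwa [P.conjWall_eq_iff, inv_inv]

theorem crossing_mul_n_left (g : G) (s : P.S) {H : P.Wall}
    (h : H = P.conjWall (P.π g) (P.simpleWall s)) (hs : ¬ P.Separates H 1 (P.π g)) :
    (o.crossing 1 (g * P.n s)).left H = Multiplicative.ofAdd ((o.toFun g s : ℤˣ) : ℤ) := by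
  rw [crossing_mul, SemidirectProduct.mul_left, Pi.mul_apply,
    o.crossing_left_of_not_separates 1 g hs, crossing_n, crossing_right,
    ExtendedCoxeterGroup.wallAction_apply, step_wallTau_left, if_pos, one_mul, one_mul]
  rw [P.conjWall_eq_iff, inv_inv, h]

/-- Both g n_s and g' n_{s'} lie beyond H as seen from 1, so the passage from one to the other
contributes nothing at H. The signed count at H is therefore the same for both, and it equals o(g,
s) and o(g', s'). -/
theorem toFun_eq_of_wall_eq {g g' : G} {s s' : P.S} {H : P.Wall}
    (h : H = P.conjWall (P.π g) (P.simpleWall s)) (hs : ¬ P.Separates H 1 (P.π g))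
    (h' : H = P.conjWall (P.π g') (P.simpleWall s')) (hs' : ¬ P.Separates H 1 (P.π g')) :
    o.toFun g s = o.toFun g' s' := by
  have h1 := o.crossing_mul_n_left g s h hs
  have h2 := o.crossing_mul_n_left g' s' h' hs'
  have h3 : g' * P.n s' = g * P.n s * ((g * P.n s)⁻¹ * (g' * P.n s')) := by
    rw [mul_inv_cancel_left]
  have h4 : P.Separates H 1 (P.π (g * P.n s)) := by
    rw [map_mul, P.π_n, P.separates_one_mul_simple]; tauto
  have h5 : P.Separates H 1 (P.π (g' * P.n s')) := by
    rw [map_mul, P.π_n, P.separates_one_mul_simple]; tauto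
  rw [h3, map_mul, P.separates_one_mul] at h5
  rw [h3, crossing_mul, SemidirectProduct.mul_left, Pi.mul_apply, crossing_right,
    ExtendedCoxeterGroup.wallAction_apply, o.crossing_left_of_not_separates _ ((g * P.n s)⁻¹ * (g' * P.n s')) (by tauto),
    mul_one, h1] at h2
  exact Units.ext (Multiplicative.ofAdd.injective h2)

theorem wallSign_one_eq {g : G} {s : P.S} {H : P.Wall}
    (h : H = P.conjWall (P.π g) (P.simpleWall s)) (hs : ¬ P.Separates H 1 (P.π g)) :
    o.wallSign 1 H = o.toFun g s := by
  obtain ⟨h1, h2⟩ := P.base_spec H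
  rw [wallSign, one_mul]
  exact o.toFun_eq_of_wall_eq (P.wall_ext (by simp [h1])) h2 h hs

end Orientation
end ProP

/-! ### The action on R[T] and the subalgebra R[T] of the Hecke algebra -/

namespace ProP

namespace ProPCoxeterGroup

variable {G W : Type*} [Group G] [Group W] (P : ProPCoxeterGroup G W)
  {R : Type*} [CommRing R]

theorem conj_mem_T (g : G) {t : G} (ht : t ∈ P.T) : g * t * g⁻¹ ∈ P.T :=
  P.π.normal_ker.conj_mem t ht g

theorem actT_single (g : G) {t : G} (ht : t ∈ P.T) (r : R) :
    P.actT R g (MonoidAlgebra.single ⟨t, ht⟩ r) =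
      MonoidAlgebra.single ⟨g * t * g⁻¹, P.conj_mem_T g ht⟩ r := by
  simp only [actT, MonoidAlgebra.mapDomainAlgHom_apply]
  exact MonoidAlgebra.mapDomain_single

theorem actT_mul (g h : G) (c : MonoidAlgebra R P.T) :
    P.actT R (g * h) c = P.actT R g (P.actT R h c) := by
  induction c using MonoidAlgebra.induction_linear with
  | zero => simp
  | add x y hx hy => simp [hx, hy]
  | single t r =>
    obtain ⟨t, ht⟩ := t
    rw [P.actT_single, P.actT_single, P.actT_single]
    congr 1
    exact Subtype.ext (by simp [mul_assoc])

theorem actT_of_mem {t : G} (ht : t ∈ P.T) (c : MonoidAlgebra R P.T) : P.actT R t c = c := by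
  induction c using MonoidAlgebra.induction_linear with
  | zero => simp
  | add x y hx hy => simp [hx, hy]
  | single t' r =>
    obtain ⟨t', ht'⟩ := t'
    rw [P.actT_single]
    congr 1
    exact Subtype.ext (by simp [P.T_comm t ht t' ht'])

theorem T_algebra_comm (c c' : MonoidAlgebra R P.T) : c * c' = c' * c := by
  induction c using MonoidAlgebra.induction_linear with
  | zero => simp
  | add x y hx hy => rw [add_mul, mul_add, hx, hy]
  | single t r =>
    induction c' using MonoidAlgebra.induction_linear with
    | zero => simp
    | add x y hx hy => rw [mul_add, add_mul, hx, hy]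
    | single t' r' =>
      rw [MonoidAlgebra.single_mul_single, MonoidAlgebra.single_mul_single, mul_comm r,
        show t * t' = t' * t from Subtype.ext (P.T_comm t t.2 t' t'.2)]

theorem simple_mul_cancel_left (s : P.S) (w : W) : (s : W) * (s * w) = w := by
  rw [← mul_assoc, P.simple_mul_self, one_mul]

theorem sepWalls_unit {u : G} (hu : u ∈ P.Ω₁) : P.sepWalls u = ∅ := by
  ext H
  simpa [P.mem_sepWalls] using P.not_separates_of_mem hu H

theorem length_prod_le (l : List P.S) : P.length (l.map P.n).prod ≤ l.length := by
  induction l with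
  | nil => simp [P.length_unit (one_mem _)]
  | cons s l ih =>
    have := P.length_mul_le (P.n s) (l.map P.n).prod
    rw [P.length_n] at this
    simp only [List.map_cons, List.prod_cons, List.length_cons]
    omega

end ProPCoxeterGroup

namespace HeckeParam

variable {G W : Type*} [Group G] [Group W] {P : ProPCoxeterGroup G W}
  {R : Type*} [CommRing R] (D : HeckeParam P R)

theorem T_one : D.T (1 : G) = 1 := D.evalOne_injective (by rw [evalOne_T]; rfl)

theorem ofT_single {t : G} (ht : t ∈ P.T) (r : R) :
    D.ofT (MonoidAlgebra.single ⟨t, ht⟩ r) = r • D.T t := by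
  have : (MonoidAlgebra.single ⟨t, ht⟩ r : MonoidAlgebra R P.T) =
      r • MonoidAlgebra.basis P.T R ⟨t, ht⟩ := by simp
  rw [this, map_smul, ofT, Module.Basis.constr_basis]

theorem T_mul_unit (g : G) {u : G} (hu : u ∈ P.Ω₁) : D.T (g * u) = D.T g * D.T u :=
  D.T_mul_T (by rw [P.length_mul_unit g hu, P.length_unit hu, add_zero])

theorem T_unit_mul (g : G) {u : G} (hu : u ∈ P.Ω₁) : D.T (u * g) = D.T u * D.T g :=
  D.T_mul_T (by rw [P.length_unit_mul g hu, P.length_unit hu, zero_add])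

theorem ofT_mul (c c' : MonoidAlgebra R P.T) : D.ofT (c * c') = D.ofT c * D.ofT c' := by
  induction c using MonoidAlgebra.induction_linear with
  | zero => simp
  | add x y hx hy => simp only [add_mul, map_add, hx, hy]
  | single t r =>
    induction c' using MonoidAlgebra.induction_linear with
    | zero => simp
    | add x y hx hy => simp only [mul_add, map_add, hx, hy]
    | single t' r' =>
      obtain ⟨t, ht⟩ := t
      obtain ⟨t', ht'⟩ := t'
      rw [MonoidAlgebra.single_mul_single]
      rw [ofT_single, ofT_single, MulMemClass.mk_mul_mk, ofT_single,
        D.T_mul_unit _ (P.T_le ht'), smul_mul_smul_comm]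

theorem T_mul_ofT (g : G) (c : MonoidAlgebra R P.T) :
    D.T g * D.ofT c = D.ofT (P.actT R g c) * D.T g := by
  induction c using MonoidAlgebra.induction_linear with
  | zero => simp
  | add x y hx hy => simp only [mul_add, add_mul, map_add, hx, hy]
  | single t r =>
    obtain ⟨t, ht⟩ := t
    rw [P.actT_single, ofT_single, ofT_single, mul_smul_comm, smul_mul_assoc,
      ← D.T_mul_unit g (P.T_le ht), ← D.T_unit_mul g (P.T_le (P.conj_mem_T g ht)),
      inv_mul_cancel_right]

/-- In the compatibility condition for b with g = n_s⁻¹ and t = s, the correcting element of `T` is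
trivial. -/
theorem actT_n_inv (s : P.S) : P.actT R (P.n s)⁻¹ (D.b s) = D.b s := by
  have h : (s : W) * P.π (P.n s)⁻¹ = P.π (P.n s)⁻¹ * s := by simp [P.π_n]
  have := D.b_eq s s (P.n s)⁻¹ h
  have h1 : (⟨P.n s * (P.n s)⁻¹ * (P.n s)⁻¹ * (P.n s)⁻¹⁻¹, P.twist_mem h⟩ : P.T) = 1 :=
    Subtype.ext (by simp)
  rwa [h1, ← MonoidAlgebra.one_def, one_mul] at this

theorem actT_n (s : P.S) : P.actT R (P.n s) (D.b s) = D.b s := by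
  conv_lhs => rw [← D.actT_n_inv s, ← P.actT_mul, mul_inv_cancel]
  exact P.actT_of_mem (one_mem _) _

/-! ### The normalized Bernstein map as a cocycle -/

namespace SqrtChoice

variable {D} (q : D.SqrtChoice)

/-- The product of the chosen square roots over the walls which separate `1` and `g`. -/
noncomputable def rho (g : G) : Rˣ := ∏ H ∈ P.sepWalls g, q.root H

theorem root_conjWall (w : W) (H : P.Wall) : q.root (P.conjWall w H) = q.root H :=
  q.root_conj w H _ rfl

/-- When lengths add, the walls of gh are the disjoint union of the walls of g and the translates by
g of those of h; the roots are invariant under conjugation. -/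
theorem rho_lengthMul : P.LengthMul q.rho := by
  classical
  intro g h hl
  rw [ProPCoxeterGroup.length, map_mul] at hl
  have h1 : P.sepWalls (g * h) = P.sepWalls g ∪ (P.sepWalls h).image (P.conjWall (P.π g)) := by
    ext H
    have h3 := P.not_separates_of_len_mul hl (H := H)
    simp only [Finset.mem_union, Finset.mem_image, P.mem_sepWalls, map_mul, P.conjWall_eq_iff,
      exists_eq_right, P.separates_one_mul H (P.π g) (P.π h)]
    tauto
  have h2 : Disjoint (P.sepWalls g) ((P.sepWalls h).image (P.conjWall (P.π g))) := by
    rw [Finset.disjoint_left]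
    intro H hH
    simp only [Finset.mem_image, P.mem_sepWalls, P.conjWall_eq_iff, exists_eq_right] at hH ⊢
    exact P.not_separates_of_len_mul hl hH
  rw [rho, h1, Finset.prod_union h2, Finset.prod_image]
  · simp only [root_conjWall, rho]
  · intro H _ H' _ he
    have he' : P.conjWall (P.π g) H = P.conjWall (P.π g) H' := he
    rw [P.conjWall_eq_iff, ← P.conjWall_mul, inv_mul_cancel, P.conjWall_one] at he'
    exact he'

theorem rho_unit {u : G} (hu : u ∈ P.Ω₁) : q.rho u = 1 := by
  rw [rho, P.sepWalls_unit hu, Finset.prod_empty]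

theorem rho_n (s : P.S) : q.rho (P.n s) = q.root (P.simpleWall s) := by
  have : P.sepWalls (P.n s) = {P.simpleWall s} := by
    ext H
    rw [P.mem_sepWalls, P.π_n, P.separates_one_simple, Finset.mem_singleton]
  rw [rho, this, Finset.prod_singleton]

/-- The normalized basis element of the Hecke algebra. -/
noncomputable def tauVal (g : G) : D.Hecke := (((q.rho g)⁻¹ : Rˣ) : R) • D.T g

theorem tauVal_mul {g h : G} (hl : P.length (g * h) = P.length g + P.length h) :
    q.tauVal (g * h) = q.tauVal g * q.tauVal h := by
  rw [tauVal, tauVal, tauVal, q.rho_lengthMul g h hl, D.T_mul_T hl, smul_mul_smul_comm, mul_inv,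
    Units.val_mul]

theorem tauVal_unit {u : G} (hu : u ∈ P.Ω₁) : q.tauVal u = D.T u := by
  rw [tauVal, q.rho_unit hu, inv_one, Units.val_one, one_smul]

theorem isUnit_T_unit {u : G} (hu : u ∈ P.Ω₁) : IsUnit (D.T u) := by
  refine ⟨⟨D.T u, D.T u⁻¹, ?_, ?_⟩, rfl⟩
  · rw [← D.T_mul_unit _ (inv_mem hu), mul_inv_cancel, D.T_one]
  · rw [← D.T_mul_unit _ hu, inv_mul_cancel, D.T_one]

/-- The element `√a_s⁻¹ (T_{n_s} - b_s)`. -/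
noncomputable def negStep (s : P.S) : D.Hecke :=
  (((q.root (P.simpleWall s))⁻¹ : Rˣ) : R) • (D.T (P.n s) - D.ofT (D.b s))

/-- This is the quadratic relation in the form T_{n_s}(T_{n_s} - b_s) = a_s T_{n_s²}, where the two
inverse roots cancel a_s. -/
theorem tauVal_n_mul_negStep (s : P.S) :
    q.tauVal (P.n s) * q.negStep s = D.T (P.n s * P.n s) := by
  rw [tauVal, negStep, rho_n, smul_mul_smul_comm, mul_sub, D.T_n_mul_T_n, add_sub_cancel_right,
    smul_smul, ← q.root_sq s, pow_two, ← Units.val_mul, ← Units.val_mul, ← Units.val_mul]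
  simp [mul_assoc]

theorem commute_tauVal_negStep (s : P.S) : Commute (q.tauVal (P.n s)) (q.negStep s) := by
  refine Commute.smul_left (Commute.smul_right (Commute.sub_right (Commute.refl _) ?_) _) _
  rw [Commute, SemiconjBy, D.T_mul_ofT, D.actT_n]

theorem isUnit_tauVal (g : G) : IsUnit (q.tauVal g) := by
  induction hk : P.length g generalizing g with
  | zero =>
    have hg := (P.length_eq_zero_iff g).1 hk
    rw [q.tauVal_unit hg]
    exact isUnit_T_unit hg
  | succ k ih =>
    obtain ⟨s, g', rfl, hl⟩ := P.exists_left_factor (g := g) (by omega)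
    rw [q.tauVal_mul (by rw [hl, P.length_n, add_comm])]
    refine IsUnit.mul ?_ (ih g' (by omega))
    refine ((q.commute_tauVal_negStep s).isUnit_mul_iff.1 ?_).1
    rw [q.tauVal_n_mul_negStep]
    exact isUnit_T_unit (P.T_le (P.n_mul_n_mem s))

/-- The normalized basis element of the Hecke algebra, as a unit. -/
noncomputable def tau (g : G) : D.Heckeˣ := (q.isUnit_tauVal g).unit

theorem coe_tau (g : G) : (q.tau g : D.Hecke) = q.tauVal g := rfl

theorem tau_lengthMul : P.LengthMul q.tau := fun _ _ hl => Units.ext (q.tauVal_mul hl)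

/-- This identifies the negative value of the abstract cocycle with the factor T_{n_s} - b_s of the
Bernstein map. Cancel the unit T_{n_s²} in the quadratic relation, using τ(n_s) = T_{n_s²} τ(n_s⁻¹).
-/
theorem coe_tau_n_inv_inv (s : P.S) : (((q.tau (P.n s)⁻¹)⁻¹ : D.Heckeˣ) : D.Hecke) = q.negStep s := by
  refine Units.inv_eq_of_mul_eq_one_right ?_
  have hu := P.T_le (P.n_mul_n_mem s)
  have h1 : q.tauVal (P.n s) = D.T (P.n s * P.n s) * q.tauVal (P.n s)⁻¹ := by
    have := q.tau_lengthMul.unit_mul (P.n s)⁻¹ hu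
    rw [mul_inv_cancel_right] at this
    simpa [coe_tau, q.tauVal_unit hu] using congrArg Units.val this
  have h2 := q.tauVal_n_mul_negStep s
  rw [h1, mul_assoc] at h2
  exact (isUnit_T_unit hu).mul_left_cancel (h2.trans (mul_one _).symm)

/-- The normalized Bernstein map starting at `g`. -/
noncomputable def theta (o : Orientation P) (g h : G) : D.Hecke :=
  (q.tau_lengthMul.cocycle o g h : D.Heckeˣ)

theorem theta_mul (o : Orientation P) (g h h' : G) :
    q.theta o g (h * h') = q.theta o g h * q.theta o (g * h) h' := by
  rw [theta, q.tau_lengthMul.cocycle_mul, Units.val_mul]; rfl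

theorem theta_unit (o : Orientation P) (g : G) {u : G} (hu : u ∈ P.Ω₁) :
    q.theta o g u = D.T u := by
  rw [theta, q.tau_lengthMul.cocycle_unit o g hu, coe_tau, q.tauVal_unit hu]

theorem theta_congr {o o' : Orientation P} {g g' : G}
    (h : ∀ x s, o.toFun (g * x) s = o'.toFun (g' * x) s) (x : G) :
    q.theta o g x = q.theta o' g' x := by
  rw [theta, q.tau_lengthMul.cocycle_congr h]; rfl

theorem theta_n (o : Orientation P) (g : G) (s : P.S) :
    q.theta o g (P.n s) = (((q.root (P.simpleWall s))⁻¹ : Rˣ) : R) •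
      (if o.toFun g s = 1 then D.T (P.n s) else D.T (P.n s) - D.ofT (D.b s)) := by
  rw [theta, q.tau_lengthMul.cocycle_n, ProPCoxeterGroup.LengthMul.step]
  split_ifs
  · rw [coe_tau, tauVal, rho_n]
  · rw [coe_tau_n_inv_inv, negStep]

theorem theta_prod (o : Orientation P) (g : G) (l : List P.S)
    (hl : P.length (l.map P.n).prod = l.length) :
    q.theta o g (l.map P.n).prod =
      (((q.rho (l.map P.n).prod)⁻¹ : Rˣ) : R) • D.thetaWord o g l := by
  induction l generalizing g with
  | nil =>
    rw [List.map_nil, List.prod_nil, q.theta_unit o g (one_mem _), q.rho_unit (one_mem _), D.T_one]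
    simp [thetaWord]
  | cons s l ih =>
    have h1 := P.length_prod_le l
    have h2 := P.length_mul_le (P.n s) (l.map P.n).prod
    rw [P.length_n] at h2
    simp only [List.map_cons, List.prod_cons, List.length_cons] at hl ⊢
    rw [theta_mul, theta_n, ih _ (by omega), smul_mul_smul_comm, thetaWord,
      q.rho_lengthMul _ _ (by rw [P.length_n]; omega), rho_n, mul_inv, Units.val_mul]

/-- The argument works for every reduced expression, so it also shows that the Bernstein map does
not depend on the chosen one. -/
theorem thetaTilde_eq (o : Orientation P) (g : G) : q.thetaTilde o g = q.theta o 1 g := by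
  have key : ∀ (l : List P.S) (u : G), u ∈ P.Ω₁ ∧ g = (l.map P.n).prod * u ∧
      P.length g = l.length →
      (((q.rho g)⁻¹ : Rˣ) : R) • (D.thetaWord o 1 l * D.T u) = q.theta o 1 g := by
    rintro l u ⟨hu, rfl, hl⟩
    rw [P.length_mul_unit _ hu] at hl
    rw [theta_mul, q.theta_prod o 1 l hl, q.theta_unit _ _ hu, smul_mul_assoc,
      q.rho_lengthMul.mul_unit _ hu, q.rho_unit hu, mul_one]
  exact key _ _ (P.exists_reduced g).choose_spec.choose_spec

/-! ### The elements Ξ and the comparison of adjacent orientations -/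

/-- Evaluate the cocycle on g t = (g t g⁻¹) g in two ways; moving the starting point by an element
of `T` does not change any sign. -/
theorem theta_mul_ofT (o : Orientation P) (x g : G) (c : MonoidAlgebra R P.T) :
    q.theta o x g * D.ofT c = D.ofT (P.actT R g c) * q.theta o x g := by
  induction c using MonoidAlgebra.induction_linear with
  | zero => simp
  | add y z hy hz => simp only [mul_add, add_mul, map_add, hy, hz]
  | single t r =>
    obtain ⟨t, ht⟩ := t
    have ht' := P.conj_mem_T g ht
    rw [P.actT_single, ofT_single, ofT_single, mul_smul_comm, smul_mul_assoc]
    congr 1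
    have h1 := q.theta_mul o x g t
    have h2 := q.theta_mul o x (g * t * g⁻¹) g
    rw [inv_mul_cancel_right] at h2
    rw [q.theta_unit _ _ (P.T_le ht)] at h1
    rw [q.theta_unit _ _ (P.T_le ht'), q.theta_congr (o := o) (o' := o) (g := x * (g * t * g⁻¹)) (g' := x)] at h2
    · rw [← h1, h2]
    · intro y s
      refine o.toFun_congr ?_ s
      rw [map_mul, map_mul P.π x, MonoidHom.mem_ker.1 ht', mul_one, map_mul]

/-- Independence of Ξ from the choice of (v, s). The two lifts of the wall are x and x r with r in
`T`, and the compatibility condition, conjugated by v, reads v(b_s) = r v'(b_{s'}). The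
discrepancies cancel because x fixes both v(b_s) and v'(b_{s'}). -/
theorem ofT_mul_theta_eq (o : Orientation P) {v v' : G} {s s' : P.S}
    (h : P.π v * s * (P.π v)⁻¹ = P.π v' * s' * (P.π v')⁻¹) :
    D.ofT (P.actT R v (D.b s)) * q.theta o 1 (v * (P.n s)⁻¹ * v⁻¹) =
      D.ofT (P.actT R v' (D.b s')) * q.theta o 1 (v' * (P.n s')⁻¹ * v'⁻¹) := by
  have hg : (s : W) * P.π (v⁻¹ * v') = P.π (v⁻¹ * v') * s' := by
    rw [map_mul, map_inv]
    rw [mul_inv_eq_iff_eq_mul] at h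
    rw [← mul_assoc, ← mul_right_inj (P.π v), ← mul_assoc, ← mul_assoc, h]
    simp [mul_assoc]
  have hb := D.b_eq s s' (v⁻¹ * v') hg
  have ht := P.twist_mem hg
  have hr := P.conj_mem_T v ht
  have hb' := congrArg (P.actT R v) hb
  rw [map_mul, P.actT_single, ← P.actT_mul, mul_inv_cancel_left] at hb'
  set r := v * (P.n s * (v⁻¹ * v') * (P.n s')⁻¹ * (v⁻¹ * v')⁻¹) * v⁻¹ with hrdef
  set x := v * (P.n s)⁻¹ * v⁻¹ with hx
  have hxr : v' * (P.n s')⁻¹ * v'⁻¹ = x * r := by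
    rw [hx, hrdef]; simp [mul_assoc]
  have h1 : P.actT R x (P.actT R v (D.b s)) = P.actT R v (D.b s) := by
    rw [← P.actT_mul, hx, inv_mul_cancel_right, P.actT_mul, D.actT_n_inv]
  have h2 : P.actT R x (P.actT R v' (D.b s')) = P.actT R v' (D.b s') := by
    rw [← P.actT_of_mem hr (P.actT R v' (D.b s')), ← P.actT_mul, ← hxr, P.actT_of_mem hr,
      ← P.actT_mul, inv_mul_cancel_right, P.actT_mul, D.actT_n_inv]
  have h3 : q.theta o 1 (x * r) =
      D.ofT (P.actT R x (MonoidAlgebra.single ⟨r, hr⟩ 1)) * q.theta o 1 x := by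
    rw [← theta_mul_ofT, ofT_single, one_smul, theta_mul, q.theta_unit _ _ (P.T_le hr)]
  rw [hxr, h3, ← mul_assoc, ← D.ofT_mul, ← h1, ← hb', map_mul, h2, P.T_algebra_comm]

theorem Xi_eq (o : Orientation P) (v : G) (s : P.S) :
    q.Xi o (P.conjWall (P.π v) (P.simpleWall s)) = (((q.root (P.simpleWall s))⁻¹ : Rˣ) : R) •
      (D.ofT (P.actT R v (D.b s)) * q.theta o 1 (v * (P.n s)⁻¹ * v⁻¹)) := by
  obtain ⟨h, -⟩ := P.base_spec (P.conjWall (P.π v) (P.simpleWall s))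
  generalize hH : P.conjWall (P.π v) (P.simpleWall s) = H at *
  have h1 : q.root (P.simpleWall (P.baseSimple H)) = q.root (P.simpleWall s) := by
    rw [← q.root_conjWall (P.π v) (P.simpleWall s), hH]
    exact (q.root_conj (P.π (P.base H)) _ _ (by simp [h])).symm
  rw [Xi, thetaTilde_eq, h1, q.ofT_mul_theta_eq o (v' := v) (s' := s)]
  rw [h, ← hH]; simp

/-- The only place where adjacency is used. The two factors at n_s differ by ±√a_s⁻¹ b_s; moving b_s
to the left turns it into g(b_s), and reflecting the starting point in the wall turns θ_o'(1, g)
into θ_o'(1, x) θ_o(1, g n_s). -/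
theorem theta_sub_theta (o o' : Orientation P) (h : o.Adjacent o') (g : G) (s : P.S)
    (hl : P.length (g * P.n s) = P.length g + 1)
    (hd : o.Disagree o' (P.conjWall (P.π g) (P.simpleWall s))) :
    q.theta o' 1 g * (q.theta o g (P.n s) - q.theta o' g (P.n s)) =
      ((o.wallSign 1 (P.conjWall (P.π g) (P.simpleWall s)) : ℤˣ) : ℤ) •
        q.Xi o' (P.conjWall (P.π g) (P.simpleWall s)) * q.theta o 1 (g * P.n s) := by
  have hs : ¬ P.Separates (P.conjWall (P.π g) (P.simpleWall s)) 1 (P.π g) := by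
    rw [P.separates_conjWall_simpleWall]
    simp only [ProPCoxeterGroup.length, map_mul, P.π_n] at hl
    omega
  have hd' := hd
  rw [Orientation.Disagree, o.wallSign_one_eq rfl hs, o'.wallSign_one_eq rfl hs] at hd'
  have h1 : q.theta o g (P.n s) - q.theta o' g (P.n s) = ((o.toFun g s : ℤˣ) : ℤ) •
      (((q.root (P.simpleWall s))⁻¹ : Rˣ) : R) • D.ofT (D.b s) := by
    rw [theta_n, theta_n, ← smul_sub]
    rcases Int.units_eq_one_or (o.toFun g s) with ho | ho <;>
      rcases Int.units_eq_one_or (o'.toFun g s) with ho' | ho'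
    · exact absurd (ho.trans ho'.symm) hd'
    · simp [ho, ho']
    · simp [ho, ho']
    · exact absurd (ho.trans ho'.symm) hd'
  set x := g * (P.n s)⁻¹ * g⁻¹ with hx
  have hπx : P.π x = ((P.conjWall (P.π g) (P.simpleWall s) : P.aff) : W) := by
    simp [hx, P.π_n, P.inv_coe_simple]
  have hxx : P.π (x * x) = 1 := by
    simp [hx, P.π_n, P.inv_coe_simple, P.simple_mul_cancel_left, mul_assoc]
  -- Adjacency gives o(x y, t) = o'(y, t). What is needed is o(y, t) = o'(x y, t), which follows
  -- because x² lies in `T`.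
  have h2 : q.theta o 1 (g * P.n s) = q.theta o' (1 * x) (g * P.n s) := by
    refine q.theta_congr (fun y t => ?_) _
    rw [one_mul, one_mul, ← h _ hd x hπx, ← mul_assoc]
    exact o.toFun_congr (by rw [map_mul, hxx, one_mul]) t
  have h3 : x * (g * P.n s) = g := by simp [hx, mul_assoc]
  rw [o.wallSign_one_eq rfl hs, h1, Xi_eq, mul_smul_comm, mul_smul_comm, theta_mul_ofT,
    smul_mul_assoc, smul_mul_assoc, mul_assoc, h2, ← theta_mul, h3]

theorem theta_sub (o o' : Orientation P) (h : o.Adjacent o') (w : G) :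
    q.theta o 1 w - q.theta o' 1 w =
      (∑ H ∈ o.diffWalls o' w, ((o.wallSign 1 H : ℤˣ) : ℤ) • q.Xi o' H) * q.theta o 1 w := by
  classical
  induction hk : P.length w generalizing w with
  | zero =>
    have hw := (P.length_eq_zero_iff w).1 hk
    rw [q.theta_unit _ _ hw, q.theta_unit _ _ hw, Orientation.diffWalls, P.sepWalls_unit hw]
    simp
  | succ k ih =>
    obtain ⟨g, s, rfl, hl⟩ := P.exists_right_factor (g := w) (by omega)
    have hs : ¬ P.Separates (P.conjWall (P.π g) (P.simpleWall s)) 1 (P.π g) := by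
      rw [P.separates_conjWall_simpleWall]
      simp only [ProPCoxeterGroup.length, map_mul, P.π_n] at hl
      omega
    -- Extending g to g n_s crosses exactly one new wall, so the sum gains at most one term.
    have hsep : P.sepWalls (g * P.n s) =
        insert (P.conjWall (P.π g) (P.simpleWall s)) (P.sepWalls g) := by
      ext H
      rw [Finset.mem_insert, P.mem_sepWalls, P.mem_sepWalls, map_mul, P.π_n,
        P.separates_one_mul_simple]
      by_cases hH : H = P.conjWall (P.π g) (P.simpleWall s)
      · subst hH; tauto
      · tauto
    have key := q.theta_sub_theta o o' h g s hl
    have hag : ¬ o.Disagree o' (P.conjWall (P.π g) (P.simpleWall s)) →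
        q.theta o g (P.n s) = q.theta o' g (P.n s) := by
      intro hd
      rw [Orientation.Disagree, not_not, o.wallSign_one_eq rfl hs, o'.wallSign_one_eq rfl hs] at hd
      rw [theta_n, theta_n, hd]
    have hmul : ∀ o : Orientation P, q.theta o 1 (g * P.n s) =
        q.theta o 1 g * q.theta o g (P.n s) := by
      intro o; rw [theta_mul, one_mul]
    -- In this splitting the inductive summand ends in θ_o(1, g) θ_o(g, n_s) = θ_o(1, w), so both
    -- summands have the required right factor.
    have hsplit : q.theta o 1 (g * P.n s) - q.theta o' 1 (g * P.n s) =
        (q.theta o 1 g - q.theta o' 1 g) * q.theta o g (P.n s) +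
          q.theta o' 1 g * (q.theta o g (P.n s) - q.theta o' g (P.n s)) := by
      rw [hmul, hmul]; noncomm_ring
    rw [hsplit, ih g (by omega), mul_assoc, ← hmul, Orientation.diffWalls, Orientation.diffWalls,
      hsep, Finset.filter_insert]
    split_ifs with hd
    · rw [key hd, Finset.sum_insert, add_mul, add_comm]
      simp [P.mem_sepWalls, hs]
    · rw [hag hd, sub_self, mul_zero, add_zero]

end SqrtChoice
end HeckeParam
end ProP

theorem mainTheorem3 {G W R : Type*} [Group G] [Group W] [CommRing R]
    (P : ProP.ProPCoxeterGroup G W) (D : ProP.HeckeParam P R) (q : D.SqrtChoice)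
    (o o' : ProP.Orientation P) (h : o.Adjacent o') (w : G) :
    q.thetaTilde o w - q.thetaTilde o' w =
      (∑ H ∈ o.diffWalls o' w, ((o.wallSign 1 H : ℤˣ) : ℤ) • q.Xi o' H) * q.thetaTilde o w := by
  rw [q.thetaTilde_eq, q.thetaTilde_eq]
  exact q.theta_sub o o' h w
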